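/- Let $G$ be a countable group with no finitely generated subgroup of exponential growth. Let $M$ be a compact connected one-manifold, that is, $M=[0,1]$ or $M=\mathbb{S}^1$, and let $\rho\colon G\to\mathrm{Homeo}(M)$ be a continuous action of $G$ on $M$ (elements of $G$ may reverse the orientation). Then there exists an action $\hat\rho\colon G\to\mathrm{Diff}^1(M)$ of $G$ on $M$ by $C^1$ diffeomorphisms which is semi-conjugate to $\rho$ in the following sense ($\hat\rho$ is a blow-up of $\rho$): there is a continuous surjective map $h\colon M\to M$ such that $h^{-1}(J)$ is connected for every connected set $J\subseteq M$, and such that $h\circ\hat\rho(g)=\rho(g)\circ h$ for every $g\in G$. Here a finitely generated group has exponential growth if, for some (equivalently, every) finite generating set, the balls $B(n)$ of the associated word metric satisfy $|B(n)|\ge c^n$ for some $c>1$ and all $n\in\mathbb{N}$. -/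

import Mathlib

open scoped Pointwise Manifold

/-- The ball of radius `n` around `1` for the word metric of a subset `S` of a group: the products
of `n` factors taken from `S`, from the inverses of elements of `S`, or equal to `1`; that is, the
elements of word length at most `n`. -/
def wordBall {G : Type*} [Group G] (S : Set G) (n : ℕ) : Set G :=
  (S ∪ S⁻¹ ∪ {1}) ^ n

/-- A group has exponential growth if it has a finite generating set `S` such that the cardinality
of the balls of the word metric of `S` is bounded below by `c ^ n` for some `c > 1`. (The balls are
finite, and by submultiplicativity this says that `lim |B(n)| ^ (1 / n) > 1`.) -/
def HasExponentialGrowth (G : Type*) [Group G] : Prop :=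
  ∃ S : Set G, S.Finite ∧ Subgroup.closure S = ⊤ ∧
    ∃ c : ℝ, 1 < c ∧ ∀ n : ℕ, c ^ n ≤ ((wordBall S n).ncard : ℝ)

/-- For actions `ρ'`, `ρ` of `G` on a space `M` by homeomorphisms, `ρ'` is a blow-up of `ρ`:
there is a continuous surjective equivariant map `h` from `(M, ρ')` to `(M, ρ)` such that the
preimage of every connected set is connected (the empty set, which is its own preimage, may be
counted as connected or not). -/
def IsBlowUp {G : Type*} [Group G] {M : Type*} [TopologicalSpace M] (ρ' ρ : G →* (M ≃ₜ M)) : Prop :=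
  ∃ h : M → M, Continuous h ∧ Function.Surjective h ∧
    (∀ J : Set M, IsPreconnected J → IsPreconnected (h ⁻¹' J)) ∧
    ∀ (g : G) (x : M), h (ρ' g x) = ρ g (h x)

/-- An action of `G` on a manifold `M` by homeomorphisms is a `C^1` action if every element acts
by a `C^1` map. Every element then acts by a `C^1` diffeomorphism, since the inverse of `ρ g` is
`ρ g⁻¹`. -/
def IsC1Action {G : Type*} [Group G] {E H : Type*} [NormedAddCommGroup E] [NormedSpace ℝ E]
    [TopologicalSpace H] (I : ModelWithCorners ℝ E H) {M : Type*} [TopologicalSpace M]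
    [ChartedSpace H M] (ρ : G →* (M ≃ₜ M)) : Prop :=
  ∀ g : G, ContMDiff I I 1 (ρ g)

/-! This is a Denjoy-type blow-up. Each point `z` of the orbits of a dense sequence is replaced by
an interval of length `l z`, where the lengths sum to the length of the manifold, and `g` maps the
interval at `z` to the interval at `g z` by a diffeomorphism. The resulting action is `C^1` if the
interval maps compose correctly and have derivative 1 at the ends, and if for each `g` the ratio `l
(g z) / l z` tends to 1 as `z` leaves finite sets: then all but finitely many interval maps have
derivative close to 1.

Growth enters in the choice of `l`. By `exists_length`, `G` has a length function, changed boundedly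
by each left translation, for which the number of elements of length at most `n` is finite and `exp
(o(n))`. A sequence that is `o(n)` has a majorant `f` whose increments tend to 0
(`exists_majorant_of_tendsto_div`). Taking `l z` proportional to `exp (-f (D z))`, with `D z` the
distance from `z` to the dense sequence, makes `l` summable, while `g` changes `D` boundedly and
hence `f ∘ D` negligibly far out (`exists_weight`).

The maps `stretch` form the required family on intervals. Since the intervals have full measure,
`abs_lift_sub_le` gives a mean value inequality for the blown-up maps, and continuity of the
candidate derivative makes it the derivative. The circle is treated on its universal cover. -/

open Filter Topology Set

/-! ### Length functions of subexponential growth on countable groups -/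

section Growth

variable {G : Type*} [Group G]

theorem wordBall_finite {S : Set G} (hS : S.Finite) (n : ℕ) : (wordBall S n).Finite := by
  have hT : (S ∪ S⁻¹ ∪ {1}).Finite := (hS.union hS.inv).union (finite_singleton 1)
  induction n with
  | zero => simp [wordBall]
  | succ n ih =>
    rw [wordBall, pow_succ]
    exact ih.mul hT

theorem one_mem_wordBall (S : Set G) (n : ℕ) : (1 : G) ∈ wordBall S n :=
  one_mem_pow (by simp)

theorem wordBall_ncard_pos {S : Set G} (hS : S.Finite) (n : ℕ) : 0 < (wordBall S n).ncard :=
  (ncard_pos (wordBall_finite hS n)).2 ⟨1, one_mem_wordBall S n⟩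

theorem wordBall_mono {S T : Set G} (h : S ⊆ T) {m n : ℕ} (hmn : m ≤ n) :
    wordBall S m ⊆ wordBall T n :=
  pow_subset_pow (union_subset_union_left _ (union_subset_union h (inv_subset_inv.2 h)))
    (by simp) hmn

theorem list_prod_mem_wordBall {S : Set G} (l : List G) (hl : ∀ g ∈ l, g ∈ S) :
    l.prod ∈ wordBall S l.length := by
  induction l with
  | nil => simp [wordBall]
  | cons g l ih =>
    rw [List.prod_cons, List.length_cons, wordBall, pow_succ']
    exact mul_mem_mul (.inl (.inl (hl g (by simp)))) (ih fun k hk => hl k (by simp [hk]))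

theorem subadditive_log_wordBall {S : Set G} (hS : S.Finite) :
    Subadditive fun n => Real.log ((wordBall S n).ncard : ℝ) := by
  intro m n
  have hm := wordBall_ncard_pos hS m
  have hn := wordBall_ncard_pos hS n
  rw [← Real.log_mul (by positivity) (by positivity)]
  have h := wordBall_ncard_pos hS (m + n)
  refine Real.log_le_log (by positivity) ?_
  have h2 : (wordBall S (m + n)).ncard ≤ (wordBall S m).ncard * (wordBall S n).ncard := by
    rw [wordBall, pow_add]
    exact natCard_mul_le
  exact_mod_cast h2

/-- By Fekete's lemma the limit exists and is a lower bound of the quotients for `n ≥ 1`. A positive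
limit `c` would give `|B(n)| ≥ exp (c n)` for every `n`, which is exponential growth. -/
theorem tendsto_log_wordBall_of_closure {S : Set G} (hS : S.Finite)
    (htop : Subgroup.closure S = ⊤) (hG : ¬ HasExponentialGrowth G) :
    Tendsto (fun n : ℕ => Real.log ((wordBall S n).ncard : ℝ) / n) atTop (𝓝 0) := by
  have hsub := subadditive_log_wordBall hS
  have hbdd : BddBelow (range fun n : ℕ => Real.log ((wordBall S n).ncard : ℝ) / n) :=
    ⟨0, by rintro _ ⟨n, rfl⟩; positivity⟩
  have hlim := hsub.tendsto_lim hbdd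
  have h0 : 0 ≤ hsub.lim := ge_of_tendsto' hlim fun n => by positivity
  have h1 : hsub.lim ≤ 0 := by
    by_contra! hpos
    refine hG ⟨S, hS, htop, Real.exp hsub.lim, by simpa using hpos, fun n => ?_⟩
    have hn := wordBall_ncard_pos hS n
    rcases eq_or_ne n 0 with rfl | hn0
    · rw [pow_zero]
      exact_mod_cast hn
    · have := hsub.lim_le_div hbdd hn0
      rw [le_div_iff₀ (by positivity)] at this
      rw [← Real.exp_nat_mul, mul_comm, ← Real.le_log_iff_exp_le (by positivity)]
      exact this
  rwa [le_antisymm h1 h0] at hlim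

theorem tendsto_log_wordBall (hG : ∀ H : Subgroup G, H.FG → ¬ HasExponentialGrowth H)
    {S : Set G} (hS : S.Finite) :
    Tendsto (fun n : ℕ => Real.log ((wordBall S n).ncard : ℝ) / n) atTop (𝓝 0) := by
  let H := Subgroup.closure S
  let S' : Set H := Subtype.val ⁻¹' S
  have hS' : S'.Finite := hS.preimage Subtype.val_injective.injOn
  have himg : (H.subtype : H → G) '' S' = S := by
    ext x
    constructor
    · rintro ⟨y, hy, rfl⟩
      exact hy
    · intro hx
      exact ⟨⟨x, Subgroup.subset_closure hx⟩, hx, rfl⟩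
  have key := tendsto_log_wordBall_of_closure hS' Subgroup.closure_closure_coe_preimage
    (hG H ((Subgroup.fg_iff _).2 ⟨S, rfl, hS⟩))
  refine key.congr fun n => ?_
  have : wordBall S n = (H.subtype : H → G) '' wordBall S' n := by
    rw [wordBall, wordBall, image_pow, image_union, image_union, image_inv, himg, image_singleton,
      map_one]
  rw [this, ncard_image_of_injective _ H.subtype_injective]

/-- Weighted word length, with all of `G` as alphabet. The `k`-th element is so expensive that a
word that can afford it has weight in the range where the balls of the first letters, up to `k`,
already grow slower than `exp (n / (k + 1))`. -/
theorem exists_length [Countable G]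
    (hG : ∀ H : Subgroup G, H.FG → ¬ HasExponentialGrowth H) :
    ∃ L : G → ℕ, (∀ k, ∃ c, ∀ g, L (k * g) ≤ c + L g) ∧ (∀ n, {g | L g ≤ n}.Finite) ∧
      Tendsto (fun n : ℕ => Real.log ({g | L g ≤ n}.ncard : ℝ) / n) atTop (𝓝 0) := by
  obtain ⟨e, he⟩ := Countable.exists_injective_nat G
  let F : ℕ → Set G := fun k => {g | e g ≤ k}
  have hF : ∀ k, (F k).Finite := fun k => (finite_Iic k).preimage he.injOn
  have hN : ∀ k : ℕ, ∃ N : ℕ, ∀ n ≥ N,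
      Real.log ((wordBall (F k) n).ncard : ℝ) / n ≤ 1 / ((k : ℝ) + 1) := fun k =>
    eventually_atTop.1 ((tendsto_log_wordBall hG (hF k)).eventually_le_const (by positivity))
  choose N hN using hN
  -- The sum gives `N k ≤ M k`; the summand `k` leaves only finitely many letters affordable for a
  -- given weight.
  let M : ℕ → ℕ := fun k => k + ∑ j ∈ Finset.range (k + 1), N j
  have hMN : ∀ k, N k ≤ M k := fun k =>
    (Finset.single_le_sum (f := N) (fun _ _ => Nat.zero_le _) (Finset.self_mem_range_succ k)).trans
      (Nat.le_add_left _ _)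
  have hMk : ∀ k, k ≤ M k := fun k => Nat.le_add_right _ _
  let wt : G → ℕ := fun g => M (e g) + 1
  let L : G → ℕ := fun g => sInf {m | ∃ l : List G, l.prod = g ∧ (l.map wt).sum = m}
  have hL : ∀ g, ∃ l : List G, l.prod = g ∧ (l.map wt).sum = L g := fun g =>
    Nat.sInf_mem (s := {m | ∃ l : List G, l.prod = g ∧ (l.map wt).sum = m})
      ⟨_, [g], by simp, rfl⟩
  have hlen : ∀ l : List G, l.length ≤ (l.map wt).sum := by
    intro l
    induction l with
    | nil => simp
    | cons a l ih =>
      rw [List.length_cons, List.map_cons, List.sum_cons]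
      have : 1 ≤ wt a := Nat.le_add_left _ _
      omega
  have hmem : ∀ (l : List G), ∀ g ∈ l, wt g ≤ (l.map wt).sum := fun l g hg =>
    List.single_le_sum (fun _ _ => Nat.zero_le _) _ (List.mem_map_of_mem hg)
  have hball : ∀ n k, (∀ j, M j < n → j ≤ k) → {g | L g ≤ n} ⊆ wordBall (F k) n := by
    intro n k hk g hg
    obtain ⟨l, rfl, hl⟩ := hL g
    have hg' : (l.map wt).sum ≤ n := hl.trans_le hg
    refine wordBall_mono subset_rfl ((hlen l).trans hg') (list_prod_mem_wordBall l ?_)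
    intro a ha
    exact hk _ (lt_of_lt_of_le (Nat.lt_succ_self _) ((hmem l a ha).trans hg'))
  have hfin : ∀ n, {g | L g ≤ n}.Finite := fun n =>
    (wordBall_finite (hF n) n).subset (hball n n fun j hj => ((hMk j).trans_lt hj).le)
  refine ⟨L, fun k => ⟨wt k, fun g => ?_⟩, hfin, ?_⟩
  · obtain ⟨l, hl, hl'⟩ := hL g
    exact Nat.sInf_le ⟨k :: l, by simp [hl], by simp [hl']⟩
  · rw [Metric.tendsto_atTop]
    intro ε hε
    obtain ⟨k, hk⟩ := exists_nat_one_div_lt hε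
    refine ⟨M k + 1, fun n hn => ?_⟩
    -- The largest index affordable within weight `n`. It is at least `k`, and `N k' ≤ M k' < n`
    -- makes the growth bound for `F k'` available at `n`.
    let k' := Nat.findGreatest (fun j => M j < n) n
    have hkn : M k < n := hn
    have hk' : M k' < n :=
      Nat.findGreatest_spec (P := fun j => M j < n) (((hMk k).trans_lt hkn).le) hkn
    have hmax : ∀ j, M j < n → j ≤ k' := fun j hj =>
      Nat.le_findGreatest ((hMk j).trans_lt hj).le hj
    have h1 := hN k' n ((hMN k').trans hk'.le)
    have h2 : Real.log ({g | L g ≤ n}.ncard : ℝ) ≤ Real.log ((wordBall (F k') n).ncard : ℝ) := by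
      have hle := ncard_le_ncard (hball n k' hmax) (wordBall_finite (hF k') n)
      rcases Nat.eq_zero_or_pos ({g | L g ≤ n}.ncard) with h0 | h0
      · rw [h0]; simp; positivity
      · exact Real.log_le_log (by positivity) (by exact_mod_cast hle)
    have h3 : 1 / ((k' : ℝ) + 1) ≤ 1 / ((k : ℝ) + 1) := by
      have : (k : ℝ) ≤ k' := by exact_mod_cast hmax k hkn
      gcongr
    rw [Real.dist_0_eq_abs, abs_of_nonneg (by positivity)]
    calc _ ≤ Real.log ((wordBall (F k') n).ncard : ℝ) / n := by gcongr
      _ < ε := by linarith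

end Growth

/-! ### Summable, asymptotically invariant weights on orbits -/

theorem exists_majorant_of_tendsto_div {a : ℕ → ℝ}
    (ha : Tendsto (fun n : ℕ => a n / n) atTop (𝓝 0)) :
    ∃ f : ℕ → ℝ, (∀ n, a n ≤ f n) ∧ Tendsto (fun n => f (n + 1) - f n) atTop (𝓝 0) := by
  have hbdd : BddAbove (range fun n : ℕ => |a n / n|) := (ha.abs).bddAbove_range
  let ε : ℕ → ℝ := fun k => ⨆ m, |a (m + k) / ((m + k : ℕ) : ℝ)|
  have hb : ∀ k, BddAbove (range fun m : ℕ => |a (m + k) / ((m + k : ℕ) : ℝ)|) := fun k =>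
    hbdd.mono (by rintro _ ⟨m, rfl⟩; exact ⟨m + k, rfl⟩)
  have hle : ∀ {k n}, k ≤ n → |a n / n| ≤ ε k := fun {k n} h => by
    have := le_ciSup (hb k) (n - k)
    simpa only [Nat.sub_add_cancel h] using this
  -- The suprema `ε k` of the tails bound `|a n / n|` for all `k ≤ n`, so `n` of them add up to at
  -- least `|a n|`; the increments are the `ε k`, which tend to 0. The term `|a 0|` covers `n = 0`,
  -- where the quotient is 0 by convention.
  refine ⟨fun n => |a 0| + ∑ k ∈ Finset.range n, ε k, fun n => ?_, ?_⟩
  · rcases Nat.eq_zero_or_pos n with rfl | hn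
    · simpa using le_abs_self (a 0)
    · have h1 : ∑ k ∈ Finset.range n, |a n / n| ≤ ∑ k ∈ Finset.range n, ε k :=
        Finset.sum_le_sum fun k hk => hle (Finset.mem_range.1 hk).le
      rw [Finset.sum_const, Finset.card_range, nsmul_eq_mul, abs_div, Nat.abs_cast,
        mul_div_cancel₀ _ (by positivity)] at h1
      linarith [le_abs_self (a n), abs_nonneg (a 0)]
  · simp only [Finset.sum_range_succ, ← add_assoc, add_sub_cancel_left]
    rw [Metric.tendsto_atTop] at ha ⊢
    intro δ hδ
    obtain ⟨N, hN⟩ := ha (δ / 2) (by positivity)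
    refine ⟨N, fun k hk => ?_⟩
    have h0 : 0 ≤ ε k := (abs_nonneg _).trans (hle le_rfl)
    have h1 : ε k ≤ δ / 2 := ciSup_le fun m => by
      have := hN (m + k) (by omega)
      rw [Real.dist_0_eq_abs] at this
      exact this.le
    rw [Real.dist_0_eq_abs, abs_of_nonneg h0]
    linarith

theorem exists_abs_sub_le_of_tendsto_sub {f : ℕ → ℝ}
    (hf : Tendsto (fun n => f (n + 1) - f n) atTop (𝓝 0)) (c : ℕ) {δ : ℝ} (hδ : 0 < δ) :
    ∃ K, ∀ m n, K ≤ m → K ≤ n → m ≤ c + n → n ≤ c + m → |f m - f n| ≤ δ := by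
  rw [Metric.tendsto_atTop] at hf
  obtain ⟨K, hK⟩ := hf (δ / (c + 1)) (by positivity)
  have step : ∀ j n, K ≤ n → |f (n + j) - f n| ≤ j * (δ / (c + 1)) := by
    intro j
    induction j with
    | zero => intro n _; simp
    | succ j ih =>
      intro n hn
      have h1 := ih n hn
      have h2 := (hK (n + j) (by omega)).le
      rw [Real.dist_0_eq_abs] at h2
      have h3 := abs_sub_le (f (n + (j + 1))) (f (n + j)) (f n)
      push_cast
      rw [← add_assoc] at h3 ⊢
      linarith
  have small : ∀ j : ℕ, j ≤ c → (j : ℝ) * (δ / (c + 1)) ≤ δ := by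
    intro j hj
    have : (j : ℝ) ≤ c := by exact_mod_cast hj
    rw [← mul_div_assoc, div_le_iff₀ (by positivity)]
    nlinarith
  refine ⟨K, fun m n hm hn h1 h2 => ?_⟩
  rcases le_total n m with h | h
  · obtain ⟨j, rfl⟩ := Nat.exists_eq_add_of_le h
    exact (step j n hn).trans (small j (by omega))
  · obtain ⟨j, rfl⟩ := Nat.exists_eq_add_of_le h
    rw [abs_sub_comm]
    exact (step j m hm).trans (small j (by omega))

theorem exists_weight {G M : Type*} [Group G] [Countable G] [TopologicalSpace M]
    (hG : ∀ H : Subgroup G, H.FG → ¬ HasExponentialGrowth H) (ρ : G →* (M ≃ₜ M)) (x : ℕ → M)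
    {p : ℝ} (hp : 0 < p) :
    ∃ l : M → ℝ, (∀ z, 0 ≤ l z) ∧ HasSum l p ∧ (∀ i, 0 < l (x i)) ∧
      (∀ g z, l (ρ g z) = 0 ↔ l z = 0) ∧
      ∀ g, ∀ δ > 0, {z | l z ≠ 0 ∧ δ < |Real.log (l (ρ g z) / l z)|}.Finite := by
  classical
  obtain ⟨L, hL, hfin, hlim⟩ := exists_length hG
  let Y : Set M := {z | ∃ i g, ρ g (x i) = z}
  have hY : ∀ g z, ρ g z ∈ Y ↔ z ∈ Y := by
    intro g z
    constructor
    · rintro ⟨i, k, h⟩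
      exact ⟨i, g⁻¹ * k, by
        rw [map_mul, Homeomorph.mul_apply, h, ← Homeomorph.mul_apply, ← map_mul]; simp⟩
    · rintro ⟨i, k, rfl⟩
      exact ⟨i, g * k, by rw [map_mul, Homeomorph.mul_apply]⟩
  let D : M → ℕ := fun z => sInf {m | ∃ i g, ρ g (x i) = z ∧ i + L g = m}
  have hD : ∀ z ∈ Y, ∃ i g, ρ g (x i) = z ∧ i + L g = D z := fun z ⟨i, g, h⟩ =>
    Nat.sInf_mem (s := {m | ∃ i g, ρ g (x i) = z ∧ i + L g = m}) ⟨_, i, g, h, rfl⟩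
  have hDle : ∀ k c, (∀ g, L (k * g) ≤ c + L g) → ∀ z ∈ Y, D (ρ k z) ≤ c + D z := by
    intro k c hc z hz
    obtain ⟨i, g, rfl, h⟩ := hD z hz
    have h1 : D (ρ k (ρ g (x i))) ≤ i + L (k * g) :=
      Nat.sInf_le ⟨i, k * g, by rw [map_mul, Homeomorph.mul_apply], rfl⟩
    have := hc g
    omega
  let N : ℕ → ℕ := fun n => {g | L g ≤ n}.ncard
  have hcover : ∀ n, {z | z ∈ Y ∧ D z ≤ n} ⊆
      (fun q : ℕ × G => ρ q.2 (x q.1)) '' (Set.Iic n ×ˢ {g | L g ≤ n}) := by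
    rintro n z ⟨hz, hn⟩
    obtain ⟨i, g, h, h'⟩ := hD z hz
    refine ⟨(i, g), ⟨?_, ?_⟩, h⟩
    · exact (show i ≤ n by omega)
    · exact (show L g ≤ n by omega)
  have hprodfin : ∀ n, ((Set.Iic n : Set ℕ) ×ˢ {g | L g ≤ n}).Finite := fun n =>
    (finite_Iic n).prod (hfin n)
  have hYfin : ∀ n, {z | z ∈ Y ∧ D z ≤ n}.Finite := fun n =>
    ((hprodfin n).image _).subset (hcover n)
  have hYcard : ∀ n, {z | z ∈ Y ∧ D z ≤ n}.ncard ≤ (n + 1) * N n := by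
    intro n
    refine (ncard_le_ncard (hcover n) ((hprodfin n).image _)).trans
      ((ncard_image_le (hprodfin n)).trans ?_)
    rw [ncard_prod, ncard_eq_toFinset_card' (Set.Iic n)]
    simp [N]
  -- One factor `n + 1` pays for the choice of `i` in the count of points with `D z ≤ n`; the other
  -- two leave the summable bound `1 / (n + 1) ^ 2`.
  have ha : Tendsto (fun n : ℕ => (Real.log (N n) + 3 * Real.log ((n : ℝ) + 1)) / n) atTop
      (𝓝 0) := by
    have h1 : Tendsto (fun n : ℕ => Real.log ((n : ℝ) + 1) / n) atTop (𝓝 0) := by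
      have h2 := (Real.tendsto_pow_log_div_mul_add_atTop 1 (-1) 1 one_ne_zero).comp
        (tendsto_natCast_atTop_atTop.comp (tendsto_add_atTop_nat 1))
      refine h2.congr fun n => ?_
      simp
    have h3 := hlim.add (h1.const_mul 3)
    simp only [mul_zero, add_zero] at h3
    refine h3.congr fun n => ?_
    simp only [N]
    ring
  obtain ⟨f, hf, hf'⟩ := exists_majorant_of_tendsto_div ha
  let l₀ : M → ℝ := fun z => if z ∈ Y then Real.exp (-f (D z)) else 0
  have hl₀ : ∀ z, 0 ≤ l₀ z := fun z => by
    simp only [l₀]; split_ifs <;> positivity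
  have hpos : ∀ z, l₀ z ≠ 0 ↔ z ∈ Y := fun z => by
    simp only [l₀]; split_ifs with h <;> simp [h, (Real.exp_pos _).ne']
  have hsq : Summable fun n : ℕ => 1 / ((n : ℝ) + 1) ^ 2 := by
    have := (summable_nat_add_iff 1).2 (Real.summable_one_div_nat_pow.2 one_lt_two)
    simpa using this
  have hterm : ∀ n : ℕ, ({z | z ∈ Y ∧ D z ≤ n}.ncard : ℝ) * Real.exp (-f n) ≤
      1 / ((n : ℝ) + 1) ^ 2 := by
    intro n
    have h1 : ({z | z ∈ Y ∧ D z ≤ n}.ncard : ℝ) ≤ ((n : ℝ) + 1) * N n := by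
      exact_mod_cast hYcard n
    have hn : (0 : ℝ) < (n : ℝ) + 1 := by positivity
    have h2 : (N n : ℝ) * Real.exp (-f n) * ((n : ℝ) + 1) ^ 3 ≤ 1 := by
      rcases Nat.eq_zero_or_pos (N n) with h0 | h0
      · simp [h0]
      · have h0' : (0 : ℝ) < N n := by exact_mod_cast h0
        rw [← Real.log_nonpos_iff (by positivity), Real.log_mul (by positivity) (by positivity),
          Real.log_mul (by positivity) (by positivity), Real.log_exp, Real.log_pow]
        have := hf n
        push_cast
        linarith
    calc _ ≤ ((n : ℝ) + 1) * N n * Real.exp (-f n) := by gcongr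
      _ ≤ _ := by
        rw [le_div_iff₀ (by positivity)]
        calc _ = (N n : ℝ) * Real.exp (-f n) * ((n : ℝ) + 1) ^ 3 := by ring
          _ ≤ 1 := h2
  have hsum : Summable l₀ := by
    refine summable_of_sum_le (c := ∑' n : ℕ, 1 / ((n : ℝ) + 1) ^ 2) hl₀ fun s => ?_
    have h1 : ∑ z ∈ s, l₀ z = ∑ z ∈ s with z ∈ Y, Real.exp (-f (D z)) := by
      rw [Finset.sum_filter]
    rw [h1, ← Finset.sum_fiberwise_of_maps_to
      (t := (s.filter (· ∈ Y)).image D) (g := D) fun z hz => Finset.mem_image_of_mem _ hz]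
    refine le_trans (Finset.sum_le_sum fun n _ => ?_) (hsq.sum_le_tsum _ fun n _ => by positivity)
    refine le_trans ?_ (hterm n)
    rw [Finset.sum_congr rfl (g := fun _ => Real.exp (-f n))
      (fun z hz => by rw [(Finset.mem_filter.1 hz).2]), Finset.sum_const, nsmul_eq_mul]
    gcongr
    rw [← ncard_coe_finset]
    refine ncard_le_ncard ?_ (hYfin n)
    intro z hz
    simp only [Finset.coe_filter, Finset.mem_filter, mem_ofPred_eq] at hz
    exact ⟨hz.1.2, hz.2.le⟩
  have hx : ∀ i, x i ∈ Y := fun i => ⟨i, 1, by simp⟩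
  have htot : 0 < ∑' z, l₀ z :=
    hsum.tsum_pos hl₀ (x 0) ((hl₀ _).lt_of_ne' ((hpos _).2 (hx 0)))
  set S := ∑' z, l₀ z with hS
  have hc : 0 < p / S := div_pos hp htot
  refine ⟨fun z => p / S * l₀ z, fun z => mul_nonneg hc.le (hl₀ z), ?_, fun i =>
    mul_pos hc ((hl₀ _).lt_of_ne' ((hpos _).2 (hx i))), fun g z => ?_, fun g δ hδ => ?_⟩
  · have := hsum.hasSum.mul_left (p / S)
    rwa [← hS, div_mul_cancel₀ _ htot.ne'] at this
  · simp only [mul_eq_zero, hc.ne', false_or]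
    rw [← not_iff_not]
    exact (hpos _).trans ((hY g z).trans (hpos z).symm)
  · obtain ⟨c₁, hc₁⟩ := hL g
    obtain ⟨c₂, hc₂⟩ := hL g⁻¹
    obtain ⟨K, hK⟩ := exists_abs_sub_le_of_tendsto_sub hf' (c₁ + c₂) hδ
    -- If `D z > K + c₂`, then `D (g z) ≥ K` too, since applying `g⁻¹` raises `D` by at most `c₂`;
    -- beyond `K` the function `f` hardly varies.
    refine (hYfin (K + c₂)).subset ?_
    rintro z ⟨hz, hz'⟩
    have hzY : z ∈ Y := (hpos z).1 fun h => hz (by simp [h])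
    have hgY := (hY g z).2 hzY
    refine ⟨hzY, ?_⟩
    by_contra! hbig
    have h1 := hDle g c₁ hc₁ z hzY
    have h2 := hDle g⁻¹ c₂ hc₂ _ hgY
    rw [← Homeomorph.mul_apply, ← map_mul, inv_mul_cancel, map_one, Homeomorph.one_apply] at h2
    have h3 := hK (D z) (D (ρ g z)) (by omega) (by omega) (by omega) (by omega)
    rw [mul_div_mul_left _ _ hc.ne'] at hz'
    simp only [l₀, if_pos hzY, if_pos hgY] at hz'
    rw [← Real.exp_sub, Real.log_exp] at hz'
    have h4 : -f (D (ρ g z)) - -f (D z) = f (D z) - f (D (ρ g z)) := by ring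
    rw [h4] at hz'
    linarith

/-! ### An equivariant family of interval diffeomorphisms -/

noncomputable section Stretch

/-- An equivariant family of diffeomorphisms `[0, a] → [0, b]` that are tangent to the identity at
both ends: in terms of the angles `α = π s / a` and `β = π (stretch a b s) / b`, it is the
projective map `tan β = (a / b) tan α`. -/
def stretch (a b s : ℝ) : ℝ :=
  b / Real.pi * (Real.pi * s / a + Real.arctan ((a - b) * Real.sin (Real.pi * s / a) *
    Real.cos (Real.pi * s / a) /
      (b * Real.cos (Real.pi * s / a) ^ 2 + a * Real.sin (Real.pi * s / a) ^ 2)))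

/-- The derivative of `stretch a b`. -/
def stretchDeriv (a b s : ℝ) : ℝ :=
  1 / (Real.cos (Real.pi * s / a) ^ 2 + (a / b) ^ 2 * Real.sin (Real.pi * s / a) ^ 2)

theorem mul_cos_sq_add_mul_sin_sq_pos {a b : ℝ} (ha : 0 < a) (hb : 0 < b) (α : ℝ) :
    0 < a * Real.cos α ^ 2 + b * Real.sin α ^ 2 := by
  have h := Real.sin_sq_add_cos_sq α
  have hm : 0 < min a b := lt_min ha hb
  have h1 := mul_le_mul_of_nonneg_right (min_le_left a b) (sq_nonneg (Real.cos α))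
  have h2 := mul_le_mul_of_nonneg_right (min_le_right a b) (sq_nonneg (Real.sin α))
  nlinarith

@[simp] theorem stretch_apply_zero (a b : ℝ) : stretch a b 0 = 0 := by simp [stretch]

@[simp] theorem stretch_zero_right (a s : ℝ) : stretch a 0 s = 0 := by simp [stretch]

theorem stretch_apply_self {a : ℝ} (ha : 0 < a) (b : ℝ) : stretch a b a = b := by
  have : Real.pi * a / a = Real.pi := by field_simp
  simp [stretch, this, Real.pi_ne_zero]

theorem stretch_self {a : ℝ} (ha : 0 < a) (s : ℝ) : stretch a a s = s := by
  simp only [stretch, sub_self, zero_mul, zero_div, Real.arctan_zero, add_zero]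
  field_simp

theorem stretch_sub {a : ℝ} (ha : 0 < a) (b s : ℝ) :
    stretch a b (a - s) = b - stretch a b s := by
  have h : Real.pi * (a - s) / a = Real.pi - Real.pi * s / a := by field_simp
  simp only [stretch, h, Real.sin_pi_sub, Real.cos_pi_sub, neg_sq, mul_neg, neg_div,
    Real.arctan_neg]
  field_simp
  ring

theorem one_add_stretch_slope_sq {a b S C : ℝ} (hsc : S ^ 2 + C ^ 2 = 1)
    (hN : b * C ^ 2 + a * S ^ 2 ≠ 0) :
    1 + ((a - b) * S * C / (b * C ^ 2 + a * S ^ 2)) ^ 2 =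
      (b ^ 2 * C ^ 2 + a ^ 2 * S ^ 2) / (b * C ^ 2 + a * S ^ 2) ^ 2 := by
  field_simp
  linear_combination (b ^ 2 * C ^ 2 + a ^ 2 * S ^ 2) * hsc

/-- The arctangent in `stretch` is the angle `β - α`, by the subtraction formula for `tan`. Its
argument has a denominator that never vanishes, so no branch of `tan` has to be chosen and the
formula is smooth on the whole line. -/
theorem hasDerivAt_stretch {a b : ℝ} (ha : 0 < a) (hb : 0 < b) (s : ℝ) :
    HasDerivAt (stretch a b) (stretchDeriv a b s) s := by
  have hα : HasDerivAt (fun s : ℝ => Real.pi * s / a) (Real.pi / a) s := by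
    simpa using ((hasDerivAt_id s).const_mul Real.pi).div_const a
  have hN := mul_cos_sq_add_mul_sin_sq_pos hb ha (Real.pi * s / a)
  have hs := hα.sin
  have hc := hα.cos
  have hy := ((hs.const_mul (a - b)).mul hc).div
    (((hc.pow 2).const_mul b).add ((hs.pow 2).const_mul a)) hN.ne'
  have key := (hα.add hy.arctan).const_mul (b / Real.pi)
  refine key.congr_deriv ?_
  have hQ := mul_cos_sq_add_mul_sin_sq_pos (pow_pos hb 2) (pow_pos ha 2) (Real.pi * s / a)
  have hsc := Real.sin_sq_add_cos_sq (Real.pi * s / a)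
  simp only [stretchDeriv, Pi.add_apply, Pi.mul_apply, Pi.div_apply, Pi.pow_apply]
  generalize Real.sin (Real.pi * s / a) = S at *
  generalize Real.cos (Real.pi * s / a) = C at *
  have h1 := one_add_stretch_slope_sq hsc hN.ne'
  have h2 : C ^ 2 + (a / b) ^ 2 * S ^ 2 = (b ^ 2 * C ^ 2 + a ^ 2 * S ^ 2) / b ^ 2 := by
    field_simp
  rw [h1, h2]
  have hpi := Real.pi_ne_zero
  field_simp
  simp only [Nat.add_one_sub_one, pow_one, Nat.cast_ofNat]
  linear_combination ((a - b) * (b * C ^ 2 - a * S ^ 2) + a * b) * hsc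

theorem sq_cos_stretch {a b : ℝ} (ha : 0 < a) (hb : 0 < b) (s : ℝ) :
    Real.cos (Real.pi * stretch a b s / b) ^ 2 =
      b ^ 2 * Real.cos (Real.pi * s / a) ^ 2 /
        (b ^ 2 * Real.cos (Real.pi * s / a) ^ 2 + a ^ 2 * Real.sin (Real.pi * s / a) ^ 2) := by
  have hN := mul_cos_sq_add_mul_sin_sq_pos hb ha (Real.pi * s / a)
  have hQ := mul_cos_sq_add_mul_sin_sq_pos (pow_pos hb 2) (pow_pos ha 2) (Real.pi * s / a)
  have hsc := Real.sin_sq_add_cos_sq (Real.pi * s / a)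
  have h : Real.pi * stretch a b s / b = Real.pi * s / a +
      Real.arctan ((a - b) * Real.sin (Real.pi * s / a) * Real.cos (Real.pi * s / a) /
      (b * Real.cos (Real.pi * s / a) ^ 2 + a * Real.sin (Real.pi * s / a) ^ 2)) := by
    rw [stretch]
    have hpi := Real.pi_ne_zero
    field_simp
  rw [h, Real.cos_add, Real.cos_arctan, Real.sin_arctan]
  generalize Real.sin (Real.pi * s / a) = S at *
  generalize Real.cos (Real.pi * s / a) = C at *
  have h1 := one_add_stretch_slope_sq hsc hN.ne'
  have h2 : ∀ y r : ℝ, (C * (1 / r) - S * (y / r)) ^ 2 = (C - S * y) ^ 2 / r ^ 2 := by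
    intro y r; ring
  rw [h2, Real.sq_sqrt (by positivity), h1]
  have h3 : C - S * ((a - b) * S * C / (b * C ^ 2 + a * S ^ 2)) = b * C / (b * C ^ 2 + a * S ^ 2) := by
    rw [eq_div_iff hN.ne', sub_mul, ← mul_div_assoc, div_mul_cancel₀ _ hN.ne']
    linear_combination b * C * hsc
  rw [h3]
  field_simp

/-- The slopes `a / b` and `b / c` of the projective maps multiply. Tangents determine angles only
modulo `π`, so derivatives are compared instead, together with the common value at 0; `stretchDeriv`
involves only squares, for which `sq_cos_stretch` suffices. -/
theorem stretch_stretch {a b c : ℝ} (ha : 0 < a) (hb : 0 < b) (hc : 0 < c) (s : ℝ) :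
    stretch b c (stretch a b s) = stretch a c s := by
  have hd : ∀ s, HasDerivAt (fun s => stretch b c (stretch a b s) - stretch a c s) 0 s := by
    intro s
    refine (((hasDerivAt_stretch hb hc _).comp s (hasDerivAt_stretch ha hb s)).sub
      (hasDerivAt_stretch ha hc s)).congr_deriv ?_
    have hQ := mul_cos_sq_add_mul_sin_sq_pos (pow_pos hb 2) (pow_pos ha 2) (Real.pi * s / a)
    have hR := mul_cos_sq_add_mul_sin_sq_pos (pow_pos hc 2) (pow_pos ha 2) (Real.pi * s / a)
    have h1 := sq_cos_stretch ha hb s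
    rw [stretchDeriv, Real.sin_sq (Real.pi * stretch a b s / b), h1]
    simp only [stretchDeriv]
    generalize Real.sin (Real.pi * s / a) = S at *
    generalize Real.cos (Real.pi * s / a) = C at *
    have e1 : b ^ 2 * C ^ 2 / (b ^ 2 * C ^ 2 + a ^ 2 * S ^ 2) +
        (b / c) ^ 2 * (1 - b ^ 2 * C ^ 2 / (b ^ 2 * C ^ 2 + a ^ 2 * S ^ 2)) =
        b ^ 2 * (c ^ 2 * C ^ 2 + a ^ 2 * S ^ 2) / (c ^ 2 * (b ^ 2 * C ^ 2 + a ^ 2 * S ^ 2)) := by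
      field_simp
      ring
    have e2 : C ^ 2 + (a / b) ^ 2 * S ^ 2 = (b ^ 2 * C ^ 2 + a ^ 2 * S ^ 2) / b ^ 2 := by
      field_simp
    have e3 : C ^ 2 + (a / c) ^ 2 * S ^ 2 = (c ^ 2 * C ^ 2 + a ^ 2 * S ^ 2) / c ^ 2 := by
      field_simp
    rw [e1, e2, e3]
    field_simp
    ring
  have := is_const_of_deriv_eq_zero (fun s => (hd s).differentiableAt) (fun s => (hd s).deriv) s 0
  simpa [sub_eq_zero] using this

/-- Division by zero gives the desired value: at points that are not blown up the derivative must be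
1, as at the ends of the intervals. -/
theorem stretchDeriv_zero_left (b s : ℝ) : stretchDeriv 0 b s = 1 := by simp [stretchDeriv]

theorem stretchDeriv_apply_zero (a b : ℝ) : stretchDeriv a b 0 = 1 := by simp [stretchDeriv]

theorem stretchDeriv_apply_self (a b : ℝ) : stretchDeriv a b a = 1 := by
  rcases eq_or_ne a 0 with rfl | ha
  · exact stretchDeriv_zero_left _ _
  · have : Real.pi * a / a = Real.pi := by field_simp
    simp [stretchDeriv, this]

theorem one_mul_cos_sq_add_pos {a b : ℝ} (ha : 0 < a) (hb : 0 < b) (α : ℝ) :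
    0 < Real.cos α ^ 2 + (a / b) ^ 2 * Real.sin α ^ 2 := by
  simpa using mul_cos_sq_add_mul_sin_sq_pos one_pos (by positivity : 0 < (a / b) ^ 2) α

theorem stretchDeriv_pos {a b : ℝ} (ha : 0 < a) (hb : 0 < b) (s : ℝ) : 0 < stretchDeriv a b s :=
  one_div_pos.2 (one_mul_cos_sq_add_pos ha hb _)

theorem continuous_stretchDeriv {a b : ℝ} (ha : 0 < a) (hb : 0 < b) :
    Continuous (stretchDeriv a b) := by
  unfold stretchDeriv
  refine Continuous.div (by fun_prop) (by fun_prop) fun s => (one_mul_cos_sq_add_pos ha hb _).ne'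

theorem strictMono_stretch {a b : ℝ} (ha : 0 < a) (hb : 0 < b) : StrictMono (stretch a b) :=
  strictMono_of_hasDerivAt_pos (hasDerivAt_stretch ha hb) (stretchDeriv_pos ha hb)

/-- The reciprocal of the derivative is a convex combination of `1` and `(a / b) ^ 2`, both in `[exp
(-2δ), exp (2δ)]`. -/
theorem abs_stretchDeriv_sub_one_le {a b δ : ℝ} (ha : 0 < a) (hb : 0 < b)
    (h : |Real.log (b / a)| ≤ δ) (s : ℝ) : |stretchDeriv a b s - 1| ≤ Real.exp (2 * δ) - 1 := by
  have hsc := Real.sin_sq_add_cos_sq (Real.pi * s / a)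
  have hpos := one_mul_cos_sq_add_pos ha hb (Real.pi * s / a)
  obtain ⟨h1, h2⟩ := abs_le.1 h
  have e1 : Real.exp (2 * Real.log (b / a)) = (b / a) ^ 2 := by
    rw [mul_comm, Real.exp_mul, Real.exp_log (by positivity)]; norm_num
  have e2 : Real.exp (2 * -Real.log (b / a)) = (a / b) ^ 2 := by
    rw [mul_neg, Real.exp_neg, e1, ← inv_pow, inv_div]
  have hq1 : (a / b) ^ 2 ≤ Real.exp (2 * δ) := e2 ▸ Real.exp_le_exp.2 (by linarith)
  have hq2 : Real.exp (-(2 * δ)) ≤ (a / b) ^ 2 := e2 ▸ Real.exp_le_exp.2 (by linarith)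
  have hδ : 0 ≤ δ := (abs_nonneg _).trans h
  have hE : 1 ≤ Real.exp (2 * δ) := Real.one_le_exp (by linarith)
  have hE' : Real.exp (-(2 * δ)) * Real.exp (2 * δ) = 1 := by rw [← Real.exp_add]; simp
  have hE0 := Real.exp_pos (-(2 * δ))
  have hle : Real.exp (-(2 * δ)) ≤ 1 := by nlinarith
  rw [stretchDeriv]
  generalize Real.sin (Real.pi * s / a) = S at *
  generalize Real.cos (Real.pi * s / a) = C at *
  generalize (a / b) ^ 2 = q at *
  have l1 : Real.exp (-(2 * δ)) ≤ C ^ 2 + q * S ^ 2 := by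
    nlinarith [sq_nonneg S, sq_nonneg C]
  have l2 : C ^ 2 + q * S ^ 2 ≤ Real.exp (2 * δ) := by
    nlinarith [sq_nonneg S, sq_nonneg C]
  have u1 : 1 / (C ^ 2 + q * S ^ 2) ≤ Real.exp (2 * δ) := by
    rw [div_le_iff₀ hpos]; nlinarith
  have u2 : Real.exp (-(2 * δ)) ≤ 1 / (C ^ 2 + q * S ^ 2) := by
    rw [le_div_iff₀ hpos]; nlinarith
  rw [abs_le]
  constructor
  · nlinarith
  · linarith

end Stretch

/-! ### Blow-ups of linear orders and the regularity of lifted maps -/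

noncomputable section Line

/-- The data of a blow-up of a linear order `α`: every point `x` is replaced by the interval
`[P x, P x + l x]`, the lengths `l x` are summable with total length filling the set of times `T`
up to measure zero, and `h : T → α` collapses the intervals. -/
structure BlowUpData (α : Type*) [LinearOrder α] where
  /-- The length of the interval that replaces a point. -/
  l : α → ℝ
  /-- The left end of the interval that replaces a point. -/
  P : α → ℝ
  /-- The collapsing map. -/
  h : ℝ → α
  /-- The blown-up line. -/
  T : Set ℝ
  l_nonneg : ∀ x, 0 ≤ l x
  P_h_le : ∀ t ∈ T, P (h t) ≤ t
  le_P_h : ∀ t ∈ T, t ≤ P (h t) + l (h t)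
  Icc_subset : ∀ x, Icc (P x) (P x + l x) ⊆ T
  hasSum : ∀ x y, x < y → HasSum (fun z : Ioo x y => l z) (P y - (P x + l x))
  exists_ne_zero : ∀ x y, x < y → ∃ z ∈ Ioo x y, l z ≠ 0
  ordConnected : T.OrdConnected
  uniqueDiffOn : UniqueDiffOn ℝ T

namespace BlowUpData

variable {α β : Type*} [LinearOrder α] [LinearOrder β]

theorem P_add_l_lt (D : BlowUpData α) {x y : α} (hxy : x < y) : D.P x + D.l x < D.P y := by
  obtain ⟨z, hz, hz0⟩ := D.exists_ne_zero x y hxy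
  have h := D.hasSum x y hxy
  have h1 : D.l z ≤ D.P y - (D.P x + D.l x) :=
    le_hasSum h (⟨z, hz⟩ : Ioo x y) fun w _ => D.l_nonneg w
  have h2 : 0 < D.l z := (D.l_nonneg z).lt_of_ne' hz0
  linarith

theorem h_eq (D : BlowUpData α) {x : α} {t : ℝ} (ht : t ∈ Icc (D.P x) (D.P x + D.l x)) :
    D.h t = x := by
  have hT := D.Icc_subset x ht
  have h1 := D.P_h_le t hT
  have h2 := D.le_P_h t hT
  rcases lt_trichotomy (D.h t) x with h | h | h
  · linarith [D.P_add_l_lt h, ht.1]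
  · exact h
  · linarith [D.P_add_l_lt h, ht.2]

theorem h_mem (D : BlowUpData α) {t : ℝ} (ht : t ∈ D.T) :
    t ∈ Icc (D.P (D.h t)) (D.P (D.h t) + D.l (D.h t)) := ⟨D.P_h_le t ht, D.le_P_h t ht⟩

theorem h_P (D : BlowUpData α) (x : α) : D.h (D.P x) = x :=
  D.h_eq ⟨le_rfl, by linarith [D.l_nonneg x]⟩

theorem P_mem (D : BlowUpData α) (x : α) : D.P x ∈ D.T :=
  D.Icc_subset x ⟨le_rfl, by linarith [D.l_nonneg x]⟩

theorem monotoneOn_h (D : BlowUpData α) : MonotoneOn D.h D.T := by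
  intro s hs t ht hst
  by_contra! hlt
  linarith [D.P_add_l_lt hlt, D.P_h_le s hs, D.le_P_h t ht]

/-- The blow-up of an order isomorphism. -/
def lift (D : BlowUpData α) (E : BlowUpData β) (f : α → β) (t : ℝ) : ℝ :=
  E.P (f (D.h t)) + stretch (D.l (D.h t)) (E.l (f (D.h t))) (t - D.P (D.h t))

/-- The derivative of the blow-up of an order isomorphism. -/
def liftDeriv (D : BlowUpData α) (E : BlowUpData β) (f : α → β) (t : ℝ) : ℝ :=
  stretchDeriv (D.l (D.h t)) (E.l (f (D.h t))) (t - D.P (D.h t))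

/-- The map `f` preserves the set of blown-up points, and the quotients of the lengths of
corresponding intervals tend to `1` locally. -/
structure Compatible (D : BlowUpData α) (E : BlowUpData β) (f : α → β) : Prop where
  l_eq_zero : ∀ x, E.l (f x) = 0 ↔ D.l x = 0
  finite : ∀ δ > 0, ∀ a b, {z | D.l z ≠ 0 ∧ δ < |Real.log (E.l (f z) / D.l z)| ∧
    a ≤ D.P z + D.l z ∧ D.P z ≤ b}.Finite

theorem _root_.stretch_end {a b : ℝ} (ha : 0 ≤ a) (hab : b = 0 ↔ a = 0) :
    stretch a b a = b := by
  rcases ha.eq_or_lt with rfl | ha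
  · simp [hab.2 rfl]
  · exact stretch_apply_self ha b

theorem _root_.abs_stretch_sub_le {a b c ε s₁ s₂ : ℝ} (ha : 0 ≤ a) (hb : 0 ≤ b)
    (hab : b = 0 ↔ a = 0) (h1 : 0 ≤ s₁) (h12 : s₁ ≤ s₂) (h2 : s₂ ≤ a)
    (h : ∀ r ∈ Icc s₁ s₂, |stretchDeriv a b r - c| ≤ ε) :
    |stretch a b s₂ - stretch a b s₁ - c * (s₂ - s₁)| ≤ ε * (s₂ - s₁) := by
  rcases ha.eq_or_lt with rfl | ha
  · obtain rfl : s₁ = 0 := by linarith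
    obtain rfl : s₂ = 0 := by linarith
    simp
  · have hb : 0 < b := hb.lt_of_ne' fun h => ha.ne' (hab.1 h)
    have key := (convex_Icc s₁ s₂).norm_image_sub_le_of_norm_hasDerivWithin_le
      (f := fun r => stretch a b r - c * r) (f' := fun r => stretchDeriv a b r - c) (C := ε)
      (fun r _ => ((hasDerivAt_stretch ha hb r).sub
        ((hasDerivAt_id r).const_mul c |>.congr_deriv (mul_one c))).hasDerivWithinAt)
      (fun r hr => h r hr) (left_mem_Icc.2 h12) (right_mem_Icc.2 h12)
    rw [Real.norm_eq_abs, Real.norm_eq_abs, abs_of_nonneg (sub_nonneg.2 h12)] at key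
    refine le_trans (le_of_eq (congrArg _ ?_)) key
    ring

variable {D : BlowUpData α} {E : BlowUpData β}

theorem lift_eq {f : α → β} {x : α} {t : ℝ} (ht : t ∈ Icc (D.P x) (D.P x + D.l x)) :
    D.lift E f t = E.P (f x) + stretch (D.l x) (E.l (f x)) (t - D.P x) := by
  rw [lift, D.h_eq ht]

theorem liftDeriv_eq {f : α → β} {x : α} {t : ℝ} (ht : t ∈ Icc (D.P x) (D.P x + D.l x)) :
    D.liftDeriv E f t = stretchDeriv (D.l x) (E.l (f x)) (t - D.P x) := by
  rw [liftDeriv, D.h_eq ht]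

theorem hasSum_orderIso (E : BlowUpData β) (f : α ≃o β) {x y : α} (hxy : x < y) :
    HasSum (fun z : Ioo x y => E.l (f z)) (E.P (f y) - (E.P (f x) + E.l (f x))) := by
  let e : Ioo x y ≃ Ioo (f x) (f y) := f.toEquiv.subtypeEquiv fun z => by simp
  exact e.hasSum_iff.2 (E.hasSum (f x) (f y) (f.lt_iff_lt.2 hxy))

/-- A mean value inequality that presupposes no differentiability. Between `t` and `s` lie two
partial intervals and all the intervals strictly between; each satisfies the estimate, and the
estimates can be summed because interval lengths account for the whole increment both in the source
and in the target. This excludes a singular part. -/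
theorem abs_lift_sub_le (f : α ≃o β) (hf : Compatible D E f) {s t c ε : ℝ}
    (ht : t ∈ D.T) (hs : s ∈ D.T) (hts : t ≤ s)
    (h : ∀ r ∈ Icc t s, |D.liftDeriv E f r - c| ≤ ε) :
    |D.lift E f s - D.lift E f t - c * (s - t)| ≤ ε * (s - t) := by
  have seg : ∀ x u v, D.P x ≤ u → u ≤ v → v ≤ D.P x + D.l x → t ≤ u → v ≤ s →
      |stretch (D.l x) (E.l (f x)) (v - D.P x) - stretch (D.l x) (E.l (f x)) (u - D.P x) -
        c * (v - u)| ≤ ε * (v - u) := by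
    intro x u v h1 h2 h3 h4 h5
    have := abs_stretch_sub_le (c := c) (ε := ε) (s₁ := u - D.P x) (s₂ := v - D.P x)
      (D.l_nonneg x) (E.l_nonneg _) (hf.l_eq_zero x) (by linarith) (by linarith) (by linarith)
      fun r hr => by
        have hr' : r + D.P x ∈ Icc (D.P x) (D.P x + D.l x) :=
          ⟨by linarith [hr.1], by linarith [hr.2]⟩
        have := h (r + D.P x) ⟨by linarith [hr.1], by linarith [hr.2]⟩
        rwa [liftDeriv_eq hr', add_sub_cancel_right] at this
    rwa [sub_sub_sub_cancel_right] at this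
  have ht' := D.h_mem ht
  have hs' := D.h_mem hs
  rcases (D.monotoneOn_h ht hs hts).eq_or_lt with heq | hlt
  · rw [heq] at ht'
    rw [lift_eq ht', lift_eq hs', add_sub_add_left_eq_sub]
    exact seg _ _ _ ht'.1 hts hs'.2 le_rfl le_rfl
  · set x := D.h t with hx
    set y := D.h s with hy
    have hxy := D.P_add_l_lt hlt
    have hend : ∀ z, stretch (D.l z) (E.l (f z)) (D.l z) = E.l (f z) := fun z =>
      stretch_end (D.l_nonneg z) (hf.l_eq_zero z)
    have hlx := D.l_nonneg x
    have hly := D.l_nonneg y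
    have a1 := seg x t (D.P x + D.l x) ht'.1 ht'.2 le_rfl le_rfl (by linarith [hs'.1])
    have a3 := seg y (D.P y) s le_rfl hs'.1 hs'.2 (by linarith [ht'.2]) le_rfl
    rw [add_sub_cancel_left, hend] at a1
    rw [sub_self, stretch_apply_zero, sub_zero] at a3
    have a2 : ∀ z : Ioo x y, |E.l (f z) - c * D.l z| ≤ ε * D.l z := by
      rintro ⟨z, hz⟩
      have := seg z (D.P z) (D.P z + D.l z) le_rfl (by linarith [D.l_nonneg z]) le_rfl
        (by linarith [D.P_add_l_lt hz.1, ht'.2])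
        (by linarith [D.P_add_l_lt hz.2, hs'.1])
      rwa [add_sub_cancel_left, hend, sub_self, stretch_apply_zero, sub_zero] at this
    have hD := D.hasSum x y hlt
    have hE := hasSum_orderIso E f hlt
    have hdiff := hE.sub (hD.mul_left c)
    have u1 := hasSum_le (fun z => (abs_le.1 (a2 z)).2) hdiff (hD.mul_left ε)
    have u2 := hasSum_le (fun z => (abs_le.1 (a2 z)).1) (hD.mul_left ε).neg hdiff
    rw [lift_eq ht', lift_eq hs']
    rw [abs_le] at a1 a3 ⊢
    constructor
    · linarith [a1.1, a3.1]
    · linarith [a1.2, a3.2]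

/-- Inside an interval this is continuity of `stretchDeriv`. At any other point the value is 1, and
nearby only finitely many intervals have a length ratio far from 1; these form a closed set that can
be avoided, apart from the interval containing the point itself. -/
theorem continuousOn_liftDeriv {f : α → β} (hf : Compatible D E f) :
    ContinuousOn (D.liftDeriv E f) D.T := by
  intro t ht
  set x := D.h t with hx
  have ht' := D.h_mem ht
  rw [← hx] at ht'
  rw [Metric.continuousWithinAt_iff']
  intro ε' hε'
  obtain ⟨ε, hε, hεε'⟩ := exists_between hε'
  set φ : ℝ → ℝ := fun s => stretchDeriv (D.l x) (E.l (f x)) (s - D.P x) with hφ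
  have hφc : Continuous φ := by
    rcases (D.l_nonneg x).eq_or_lt with h0 | h0
    · simp only [hφ, ← h0, stretchDeriv_zero_left]
      exact continuous_const
    · have h1 : 0 < E.l (f x) :=
        (E.l_nonneg _).lt_of_ne' fun h => h0.ne' ((hf.l_eq_zero x).1 h)
      exact (continuous_stretchDeriv h0 h1).comp (continuous_id.sub continuous_const)
  have hφt : D.liftDeriv E f t = φ t := liftDeriv_eq ht'
  have hnear : ∀ᶠ s in 𝓝[D.T] t, dist (φ s) (φ t) < ε' :=
    (Metric.continuousWithinAt_iff'.1 hφc.continuousWithinAt) ε' hε'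
  have hsame : ∀ {s}, s ∈ D.T → D.h s = x → D.liftDeriv E f s = φ s := fun {s} hs h => by
    rw [liftDeriv, h]
  by_cases hint : D.P x < t ∧ t < D.P x + D.l x
  · filter_upwards [hnear, self_mem_nhdsWithin,
      mem_nhdsWithin_of_mem_nhds (Ioo_mem_nhds hint.1 hint.2)] with s hs hsT hsI
    rwa [hsame hsT (D.h_eq ⟨hsI.1.le, hsI.2.le⟩), hφt]
  · have hφ1 : φ t = 1 := by
      rw [not_and_or, not_lt, not_lt] at hint
      rcases hint with h | h
      · have : t - D.P x = 0 := by linarith [ht'.1]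
        simp only [hφ, this, stretchDeriv_apply_zero]
      · have : t - D.P x = D.l x := by linarith [ht'.2]
        simp only [hφ, this, stretchDeriv_apply_self]
    -- Chosen so that the bound `exp (2δ) - 1` on the deviation of the derivative from 1 equals `ε`.
    set δ := Real.log (1 + ε) / 2 with hδ
    have hδ0 : 0 < δ := half_pos (Real.log_pos (by linarith))
    have hexp : Real.exp (2 * δ) - 1 = ε := by
      rw [hδ, mul_div_cancel₀ _ two_ne_zero, Real.exp_log (by linarith)]; ring
    have hfin := hf.finite δ hδ0 (t - 1) (t + 1)
    set Z := {z | D.l z ≠ 0 ∧ δ < |Real.log (E.l (f z) / D.l z)| ∧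
      t - 1 ≤ D.P z + D.l z ∧ D.P z ≤ t + 1} with hZ
    have hC : IsClosed (⋃ z ∈ Z \ {x}, Icc (D.P z) (D.P z + D.l z)) :=
      (hfin.subset sdiff_subset).isClosed_biUnion fun z _ => isClosed_Icc
    have htC : t ∉ ⋃ z ∈ Z \ {x}, Icc (D.P z) (D.P z + D.l z) := by
      simp only [mem_iUnion, not_exists]
      intro z hz htz
      exact hz.2 ((D.h_eq htz).symm.trans hx.symm)
    filter_upwards [hnear, self_mem_nhdsWithin,
      mem_nhdsWithin_of_mem_nhds (hC.isOpen_compl.mem_nhds htC),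
      mem_nhdsWithin_of_mem_nhds (Ioo_mem_nhds (sub_one_lt t) (lt_add_one t))] with
      s hs hsT hsC hsI
    by_cases hsx : D.h s = x
    · rwa [hsame hsT hsx, hφt]
    · rw [hφt, hφ1, Real.dist_eq]
      refine lt_of_le_of_lt ?_ hεε'
      have hsm := D.h_mem hsT
      set z := D.h s with hz
      rcases (D.l_nonneg z).eq_or_lt with h0 | h0
      · rw [liftDeriv, ← hz, ← h0, stretchDeriv_zero_left]
        simpa using hε.le
      · have h1 : 0 < E.l (f z) :=
          (E.l_nonneg _).lt_of_ne' fun h => h0.ne' ((hf.l_eq_zero z).1 h)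
        have hlog : |Real.log (E.l (f z) / D.l z)| ≤ δ := by
          by_contra! hbad
          refine hsC (mem_iUnion₂.2 ⟨z, ⟨⟨h0.ne', hbad, ?_, ?_⟩, hsx⟩, hsm⟩)
          · linarith [hsm.2, hsI.1]
          · linarith [hsm.1, hsI.2]
        rw [← hexp]
        exact abs_stretchDeriv_sub_one_le h0 h1 hlog _

theorem hasDerivWithinAt_lift (f : α ≃o β) (hf : Compatible D E f) {t : ℝ} (ht : t ∈ D.T) :
    HasDerivWithinAt (D.lift E f) (D.liftDeriv E f t) D.T t := by
  rw [hasDerivWithinAt_iff_isLittleO, Asymptotics.isLittleO_iff]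
  intro ε hε
  obtain ⟨δ, hδ, hδ'⟩ := Metric.continuousOn_iff.1 (continuousOn_liftDeriv hf) t ht ε hε
  filter_upwards [self_mem_nhdsWithin, mem_nhdsWithin_of_mem_nhds (Metric.ball_mem_nhds t hδ)] with
    s hs hsδ
  have hmem : ∀ r ∈ uIcc t s, |D.liftDeriv E f r - D.liftDeriv E f t| ≤ ε := by
    intro r hr
    refine (hδ' r (D.ordConnected.uIcc_subset ht hs hr) ?_).le
    refine lt_of_le_of_lt ?_ hsδ
    rw [Real.dist_eq, Real.dist_eq]
    exact abs_sub_left_of_mem_uIcc hr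
  rw [Real.norm_eq_abs, Real.norm_eq_abs, smul_eq_mul]
  rcases le_total t s with h | h
  · rw [uIcc_of_le h] at hmem
    have := abs_lift_sub_le f hf ht hs h hmem
    rwa [abs_of_nonneg (sub_nonneg.2 h), mul_comm (s - t)]
  · rw [uIcc_of_ge h] at hmem
    have := abs_lift_sub_le f hf hs ht h hmem
    rw [abs_sub_comm s t, abs_of_nonneg (sub_nonneg.2 h), ← abs_neg]
    refine le_trans (le_of_eq (congrArg _ ?_)) this
    ring

theorem contDiffOn_lift (f : α ≃o β) (hf : Compatible D E f) : ContDiffOn ℝ 1 (D.lift E f) D.T := by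
  have h := fun t (ht : t ∈ D.T) => hasDerivWithinAt_lift f hf ht
  rw [contDiffOn_one_iff_derivWithin D.uniqueDiffOn]
  refine ⟨fun t ht => (h t ht).differentiableWithinAt, ?_⟩
  exact (continuousOn_liftDeriv hf).congr fun t ht => (h t ht).derivWithin (D.uniqueDiffOn t ht)

/-- The reflection of a blow-up. -/
def dual (D : BlowUpData α) : BlowUpData αᵒᵈ where
  l x := D.l (OrderDual.ofDual x)
  P x := -(D.P (OrderDual.ofDual x) + D.l (OrderDual.ofDual x))
  h t := OrderDual.toDual (D.h (-t))
  T := -D.T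
  l_nonneg x := D.l_nonneg _
  P_h_le t ht := by
    have := D.le_P_h (-t) ht
    simp only [OrderDual.ofDual_toDual]
    linarith
  le_P_h t ht := by
    have := D.P_h_le (-t) ht
    simp only [OrderDual.ofDual_toDual]
    linarith
  Icc_subset x t ht := by
    refine D.Icc_subset (OrderDual.ofDual x) ⟨?_, ?_⟩
    · linarith [ht.2]
    · linarith [ht.1]
  hasSum x y hxy := by
    have := D.hasSum (OrderDual.ofDual y) (OrderDual.ofDual x) hxy
    let e : Ioo x y ≃ Ioo (OrderDual.ofDual y) (OrderDual.ofDual x) :=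
      OrderDual.ofDual.subtypeEquiv fun z => and_comm
    convert! e.hasSum_iff.2 this using 1
    ring
  exists_ne_zero x y hxy := by
    obtain ⟨z, hz, h⟩ := D.exists_ne_zero (OrderDual.ofDual y) (OrderDual.ofDual x) hxy
    exact ⟨OrderDual.toDual z, ⟨hz.2, hz.1⟩, h⟩
  ordConnected := by
    have := D.ordConnected
    exact this.preimage_anti (f := fun t : ℝ => -t) fun _ _ h => neg_le_neg h
  uniqueDiffOn := by
    rw [← image_neg_eq_neg]
    exact (ContinuousLinearEquiv.neg ℝ (M := ℝ)).uniqueDiffOn_image D.uniqueDiffOn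

variable (D)

/-- A bijection that preserves or reverses the order and can be blown up. -/
structure Admissible (f : α → α) : Prop where
  monotone : StrictMono f ∨ StrictAnti f
  surjective : Function.Surjective f
  compatible : Compatible D D f

open Classical in
/-- The blow-up of a bijection that preserves or reverses the order. -/
def blow (f : α → α) (t : ℝ) : ℝ :=
  D.P (f (D.h t)) + stretch (D.l (D.h t)) (D.l (f (D.h t)))
    (if StrictMono f then t - D.P (D.h t) else D.l (D.h t) - (t - D.P (D.h t)))

variable {D}

theorem contDiffOn_blow [Nontrivial α] {f : α → α} (hf : D.Admissible f) :
    ContDiffOn ℝ 1 (D.blow f) D.T := by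
  by_cases hm : StrictMono f
  · refine (contDiffOn_lift (D := D) (E := D) (hm.orderIsoOfSurjective f hf.surjective)
      hf.compatible).congr fun t ht => ?_
    simp [blow, lift, hm]
  · have ha := hf.monotone.resolve_left hm
    -- A decreasing map is increasing into the order dual, whose blow-up is the reflected one;
    -- `stretch_sub` matches the reflected formula with `blow`.
    let f' : α → αᵒᵈ := fun x => OrderDual.toDual (f x)
    have hf' : StrictMono f' := ha
    have hc : Compatible D D.dual f' := ⟨hf.compatible.l_eq_zero, hf.compatible.finite⟩
    refine (contDiffOn_lift (D := D) (E := D.dual) (hf'.orderIsoOfSurjective f' hf.surjective)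
      hc).neg.congr fun t ht => ?_
    have hl := D.l_nonneg (D.h t)
    change D.blow f t = -D.lift D.dual f' t
    simp only [blow, lift, hm, if_false, f', dual, OrderDual.ofDual_toDual]
    rcases hl.eq_or_lt with h0 | h0
    · have := (hf.compatible.l_eq_zero (D.h t)).2 h0.symm
      simp [this]
    · rw [stretch_sub h0]
      ring

theorem _root_.stretch_mem_Icc {a b s : ℝ} (ha : 0 ≤ a) (hb : 0 ≤ b) (hab : b = 0 ↔ a = 0)
    (hs : s ∈ Icc 0 a) : stretch a b s ∈ Icc 0 b := by
  rcases ha.eq_or_lt with rfl | h0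
  · simp [hab.2 rfl]
  · have hb0 : 0 < b := hb.lt_of_ne' fun h => h0.ne' (hab.1 h)
    have hm := (strictMono_stretch h0 hb0).monotone
    have h1 := hm hs.1
    have h2 := hm hs.2
    rw [stretch_apply_zero] at h1
    rw [stretch_apply_self h0] at h2
    exact ⟨h1, h2⟩

theorem blow_mem {f : α → α} (hf : Compatible D D f) {t : ℝ} (ht : t ∈ D.T) :
    D.blow f t ∈ Icc (D.P (f (D.h t))) (D.P (f (D.h t)) + D.l (f (D.h t))) := by
  have h := D.h_mem ht
  have key : ∀ s ∈ Icc 0 (D.l (D.h t)), D.P (f (D.h t)) + stretch (D.l (D.h t)) (D.l (f (D.h t))) s ∈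
      Icc (D.P (f (D.h t))) (D.P (f (D.h t)) + D.l (f (D.h t))) := by
    intro s hs
    have := stretch_mem_Icc (D.l_nonneg _) (D.l_nonneg _) (hf.l_eq_zero _) hs
    exact ⟨by linarith [this.1], by linarith [this.2]⟩
  rw [blow]
  split_ifs
  · exact key _ ⟨by linarith [h.1], by linarith [h.2]⟩
  · exact key _ ⟨by linarith [h.2], by linarith [h.1]⟩

theorem blow_mem_T {f : α → α} (hf : Compatible D D f) {t : ℝ} (ht : t ∈ D.T) :
    D.blow f t ∈ D.T := D.Icc_subset _ (blow_mem hf ht)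

theorem h_blow {f : α → α} (hf : Compatible D D f) {t : ℝ} (ht : t ∈ D.T) :
    D.h (D.blow f t) = f (D.h t) := D.h_eq (blow_mem hf ht)

theorem blow_id {t : ℝ} (ht : t ∈ D.T) : D.blow id t = t := by
  have h := D.h_mem ht
  rw [blow, if_pos strictMono_id, id]
  rcases (D.l_nonneg (D.h t)).eq_or_lt with h0 | h0
  · rw [← h0, stretch_zero_right]
    linarith [h.1, h.2]
  · rw [stretch_self h0]
    ring

open Classical in
-- The cocycle identity `stretch_stretch`, together with the commutation of `stretch` with flips of
-- the intervals. On a one-point order every map both preserves and reverses the order, so the case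
-- distinction in `blow` would lose track of flips.
theorem blow_comp [Nontrivial α] {f g : α → α} (hf : D.Admissible f) (hg : D.Admissible g) {t : ℝ}
    (ht : t ∈ D.T) : D.blow (f ∘ g) t = D.blow f (D.blow g t) := by
  rw [blow, blow, h_blow hg.compatible ht, Function.comp_apply]
  have e : D.blow g t - D.P (g (D.h t)) = stretch (D.l (D.h t)) (D.l (g (D.h t)))
      (if StrictMono g then t - D.P (D.h t) else D.l (D.h t) - (t - D.P (D.h t))) := by
    rw [blow, add_sub_cancel_left]
  rw [e]
  congr 1
  rcases (D.l_nonneg (D.h t)).eq_or_lt with h0 | h0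
  · have h1 := (hg.compatible.l_eq_zero _).2 h0.symm
    have h2 := (hf.compatible.l_eq_zero _).2 h1
    simp [h2]
  have h1 : 0 < D.l (g (D.h t)) :=
    (D.l_nonneg _).lt_of_ne' fun h => h0.ne' ((hg.compatible.l_eq_zero _).1 h)
  have h2 : 0 < D.l (f (g (D.h t))) :=
    (D.l_nonneg _).lt_of_ne' fun h => h1.ne' ((hf.compatible.l_eq_zero _).1 h)
  have hanti : ∀ {k : α → α}, StrictAnti k → ¬ StrictMono k := by
    intro k hk hk'
    obtain ⟨a, b, hab⟩ := exists_pair_lt α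
    exact lt_asymm (hk hab) (hk' hab)
  rcases hf.monotone with mf | mf <;> rcases hg.monotone with mg | mg
  · rw [if_pos mf, if_pos mg, if_pos (mf.comp mg), stretch_stretch h0 h1 h2]
  · rw [if_pos mf, if_neg (hanti mg), if_neg (hanti (mf.comp_strictAnti mg)),
      stretch_stretch h0 h1 h2]
  · rw [if_neg (hanti mf), if_pos mg, if_neg (hanti (mf.comp_strictMono mg)), ← stretch_sub h0,
      stretch_stretch h0 h1 h2]
  · rw [if_neg (hanti mf), if_neg (hanti mg), if_pos (mf.comp mg), ← stretch_sub h0,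
      stretch_stretch h0 h1 h2, sub_sub_cancel]

end BlowUpData

end Line

/-! ### Construction of a blow-up from prescribed lengths -/

noncomputable section Cumulative

open Classical in
/-- The distribution function of the measure with mass `l z` at `z`, normalized to vanish at `o`. -/
def cumulative {α : Type*} [LinearOrder α] (l : α → ℝ) (o x : α) : ℝ :=
  ∑' z, l z * ((if z < x then 1 else 0) - (if z < o then 1 else 0))

variable {α : Type*} [LinearOrder α] {l : α → ℝ} {o : α}

open Classical in
-- The indicators cancel outside the interval between `o` and `x`, so local summability is enough;
-- this allows the periodic lengths on the universal cover of the circle.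
theorem summable_cumulative (h0 : ∀ x, 0 ≤ l x)
    (hl : ∀ a b : α, Summable fun z : Ico a b => l z) (x : α) :
    Summable fun z => l z * ((if z < x then 1 else 0) - (if z < o then 1 else 0)) := by
  have h := summable_subtype_iff_indicator.1 (hl (min o x) (max o x))
  refine Summable.of_norm_bounded h fun z => ?_
  rw [Real.norm_eq_abs]
  by_cases hz : z ∈ Ico (min o x) (max o x)
  · rw [indicator_of_mem hz, abs_mul, abs_of_nonneg (h0 z)]
    refine mul_le_of_le_one_right (h0 z) ?_
    split_ifs <;> norm_num
  · rw [indicator_of_notMem hz]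
    have : z < x ↔ z < o := by
      simp only [mem_Ico, min_le_iff, lt_max_iff, not_and_or, not_or, not_le, not_lt] at hz
      rcases hz with h | h
      · exact ⟨fun _ => h.1, fun _ => h.2⟩
      · exact ⟨fun h' => absurd h' h.2.not_gt, fun h' => absurd h' h.1.not_gt⟩
    simp [this]

theorem hasSum_cumulative (h0 : ∀ x, 0 ≤ l x) (hl : ∀ a b : α, Summable fun z : Ico a b => l z)
    {x y : α} (hxy : x ≤ y) :
    HasSum (fun z : Ico x y => l z) (cumulative l o y - cumulative l o x) := by
  classical
  have h := (summable_cumulative (o := o) h0 hl y).hasSum.sub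
    (summable_cumulative (o := o) h0 hl x).hasSum
  refine (hasSum_subtype_iff_indicator (f := l) (s := Ico x y)).2 ?_
  convert! h using 2 with z
  rw [← mul_sub, sub_sub_sub_cancel_right]
  by_cases hx : z < x
  · simp [indicator, hx, hx.trans_le hxy, hx.not_ge]
  · simp [indicator, hx, not_lt.1 hx]

theorem hasSum_cumulative_Ioo (h0 : ∀ x, 0 ≤ l x) (hl : ∀ a b : α, Summable fun z : Ico a b => l z)
    {x y : α} (hxy : x < y) :
    HasSum (fun z : Ioo x y => l z) (cumulative l o y - (cumulative l o x + l x)) := by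
  classical
  have h := (hasSum_subtype_iff_indicator (f := l) (s := Ico x y)).1
    (hasSum_cumulative (o := o) h0 hl hxy.le)
  refine (hasSum_subtype_iff_indicator (f := l) (s := Ioo x y)).2 ?_
  have h2 := h.sub (hasSum_ite_eq x (l x))
  rw [sub_sub] at h2
  convert! h2 using 2 with z
  rcases lt_trichotomy z x with hz | rfl | hz
  · simp [indicator, hz.not_gt, hz.not_ge, hz.ne]
  · simp [indicator, hxy]
  · simp [indicator, hz, hz.le, hz.ne']

/-- The point is the supremum of those with `P x ≤ t`. If `t` missed its interval, finitely many
masses would already witness this, and some `y` between `x` and all of them would contradict the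
supremum: the cumulative function has no jumps besides the point masses. -/
theorem exists_mem_Icc_cumulative [DenselyOrdered α] (h0 : ∀ x, 0 ≤ l x)
    (hl : ∀ a b : α, Summable fun z : Ico a b => l z)
    (hd : ∀ x y, x < y → ∃ z ∈ Ioo x y, l z ≠ 0)
    (hlub : ∀ A : Set α, A.Nonempty → BddAbove A → ∃ x, IsLUB A x) {t : ℝ}
    (h1 : ∃ a, cumulative l o a ≤ t) (h2 : ∃ w, t ≤ cumulative l o w + l w) :
    ∃ x, t ∈ Icc (cumulative l o x) (cumulative l o x + l x) := by
  set P := cumulative l o with hP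
  have hI : ∀ {x y}, x < y → HasSum (fun z : Ioo x y => l z) (P y - (P x + l x)) :=
    fun h => hasSum_cumulative_Ioo h0 hl h
  have hlt : ∀ {x y}, x < y → P x + l x < P y := by
    intro x y hxy
    obtain ⟨z, hz, hz0⟩ := hd x y hxy
    have h1 : l z ≤ P y - (P x + l x) := le_hasSum (hI hxy) (⟨z, hz⟩ : Ioo x y) fun w _ => h0 w
    have h2 : 0 < l z := (h0 z).lt_of_ne' hz0
    linarith
  have hfin : ∀ {x y}, x < y → ∀ r < P y - (P x + l x), ∃ F : Finset α, ↑F ⊆ Ioo x y ∧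
      r < ∑ z ∈ F, l z := by
    intro x y hxy r hr
    obtain ⟨F, hF⟩ := ((hI hxy).eventually (lt_mem_nhds hr)).exists
    refine ⟨F.map (Function.Embedding.subtype _), ?_, by simpa using hF⟩
    intro z hz
    simp only [Finset.coe_map, mem_image] at hz
    obtain ⟨w, -, rfl⟩ := hz
    exact w.2
  have hge : ∀ {x y} (F : Finset α), x < y → ↑F ⊆ Ioo x y → ∑ z ∈ F, l z ≤ P y - (P x + l x) := by
    intro x y F hxy hF
    have h := sum_le_hasSum F (fun z _ => indicator_nonneg (fun z _ => h0 z) z)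
      ((hasSum_subtype_iff_indicator (f := l) (s := Ioo x y)).1 (hI hxy))
    rwa [Finset.sum_congr rfl fun z hz => indicator_of_mem (hF hz) l] at h
  obtain ⟨a, ha⟩ := h1
  obtain ⟨w, hw⟩ := h2
  obtain ⟨x, hx⟩ := hlub {x | P x ≤ t} ⟨a, ha⟩ ⟨w, fun y hy => by
    by_contra! hwy
    have hy' : P y ≤ t := hy
    linarith [hlt hwy]⟩
  refine ⟨x, ?_, ?_⟩
  · by_contra! hxt
    have hne : ∀ y, P y ≤ t → y < x := fun y hy =>
      lt_of_le_of_ne (hx.1 hy) fun h => by rw [h] at hy; linarith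
    have hax := hne a ha
    obtain ⟨F, hF, hr⟩ := hfin hax (t - (P a + l a)) (by linarith)
    have hm : (insert a F).max' (Finset.insert_nonempty a F) < x :=
      (Finset.max'_lt_iff _ _).2 fun y hy => by
        rcases Finset.mem_insert.1 hy with rfl | hy
        · exact hax
        · exact (hF hy).2
    obtain ⟨y, hy, hmy⟩ := (lt_isLUB_iff hx).1 hm
    have hlty : ∀ z ∈ insert a F, z < y := fun z hz =>
      (Finset.le_max' _ z hz).trans_lt hmy
    have := hge F (hlty a (Finset.mem_insert_self _ _)) fun z hz =>
      ⟨(hF hz).1, hlty z (Finset.mem_insert_of_mem hz)⟩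
    have hy' : P y ≤ t := hy
    linarith
  · by_contra! hxt
    have hxw : x < w := by
      by_contra! hwx
      rcases hwx.eq_or_lt with rfl | h
      · linarith
      · linarith [hlt h, h0 x]
    obtain ⟨F, hF, hr⟩ := hfin hxw (P w - t) (by linarith)
    have hm : x < (insert w F).min' (Finset.insert_nonempty w F) :=
      (Finset.lt_min'_iff _ _).2 fun y hy => by
        rcases Finset.mem_insert.1 hy with rfl | hy
        · exact hxw
        · exact (hF hy).1
    obtain ⟨y, hxy, hym⟩ := exists_between hm
    have hlty : ∀ z ∈ insert w F, y < z := fun z hz =>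
      hym.trans_le (Finset.min'_le _ z hz)
    have h3 := hge F (hlty w (Finset.mem_insert_self _ _)) fun z hz =>
      ⟨hlty z (Finset.mem_insert_of_mem hz), (hF hz).2⟩
    have hy : ¬ P y ≤ t := fun h => (hx.1 h).not_gt hxy
    linarith [h0 y]

open Classical in
/-- The blow-up with prescribed lengths. -/
def BlowUpData.ofLength [DenselyOrdered α] (l : α → ℝ) (o : α) (T : Set ℝ) (h0 : ∀ x, 0 ≤ l x)
    (hl : ∀ a b : α, Summable fun z : Ico a b => l z)
    (hd : ∀ x y, x < y → ∃ z ∈ Ioo x y, l z ≠ 0)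
    (hlub : ∀ A : Set α, A.Nonempty → BddAbove A → ∃ x, IsLUB A x)
    (h1 : ∀ t ∈ T, ∃ a, cumulative l o a ≤ t) (h2 : ∀ t ∈ T, ∃ w, t ≤ cumulative l o w + l w)
    (hI : ∀ x, Icc (cumulative l o x) (cumulative l o x + l x) ⊆ T) (hT : T.OrdConnected)
    (hu : UniqueDiffOn ℝ T) : BlowUpData α where
  l := l
  P := cumulative l o
  h t := if ht : t ∈ T then (exists_mem_Icc_cumulative h0 hl hd hlub (h1 t ht) (h2 t ht)).choose
    else o
  T := T
  l_nonneg := h0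
  P_h_le t ht := by
    rw [dif_pos ht]
    exact (exists_mem_Icc_cumulative h0 hl hd hlub (h1 t ht) (h2 t ht)).choose_spec.1
  le_P_h t ht := by
    rw [dif_pos ht]
    exact (exists_mem_Icc_cumulative h0 hl hd hlub (h1 t ht) (h2 t ht)).choose_spec.2
  Icc_subset := hI
  hasSum x y hxy := hasSum_cumulative_Ioo h0 hl hxy
  exists_ne_zero := hd
  ordConnected := hT
  uniqueDiffOn := hu

end Cumulative

/-! ### Monotone maps and actions -/

section Topology

/-- If closed sets `A`, `B` cover the preimage, their images are closed and cover `J`, so they meet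
at some `y` in `J`; the connected fiber over `y` then meets `A ∩ B`. -/
theorem IsPreconnected.preimage_of_isClosedMap_of_fibers {X Y : Type*} [TopologicalSpace X]
    [TopologicalSpace Y] {h : X → Y} (hc : IsClosedMap h) (hs : Function.Surjective h)
    (hf : ∀ y, IsPreconnected (h ⁻¹' {y})) {J : Set Y} (hJ : IsPreconnected J) :
    IsPreconnected (h ⁻¹' J) := by
  rw [isPreconnected_closed_iff] at hJ ⊢
  rintro A B hA hB hAB ⟨a, haJ, ha⟩ ⟨b, hbJ, hb⟩
  obtain ⟨y, hyJ, ⟨a', ha', ha'y⟩, ⟨b', hb', hb'y⟩⟩ := hJ (h '' A) (h '' B) (hc A hA) (hc B hB)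
    (fun y hy => by
      obtain ⟨x, rfl⟩ := hs y
      exact (hAB hy).imp (mem_image_of_mem h) (mem_image_of_mem h))
    ⟨h a, haJ, a, ha, rfl⟩ ⟨h b, hbJ, b, hb, rfl⟩
  have hsub : h ⁻¹' {y} ⊆ h ⁻¹' J := preimage_mono (singleton_subset_iff.2 hyJ)
  obtain ⟨c, hc, hc'⟩ := isPreconnected_closed_iff.1 (hf y) A B hA hB (hsub.trans hAB)
    ⟨a', ha'y, ha'⟩ ⟨b', hb'y, hb'⟩
  exact ⟨c, hsub hc, hc'⟩

/-- An action by homeomorphisms from a family of continuous maps. -/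
def homeomorphAction {G M : Type*} [Group G] [TopologicalSpace M] (φ : G → M → M)
    (h1 : ∀ x, φ 1 x = x) (hmul : ∀ g k x, φ (g * k) x = φ g (φ k x))
    (hc : ∀ g, Continuous (φ g)) : G →* (M ≃ₜ M) where
  toFun g :=
    { toFun := φ g
      invFun := φ g⁻¹
      left_inv := fun x => by rw [← hmul, inv_mul_cancel, h1]
      right_inv := fun x => by rw [← hmul, mul_inv_cancel, h1]
      continuous_toFun := hc g
      continuous_invFun := hc g⁻¹ }
  map_one' := Homeomorph.ext h1
  map_mul' g k := Homeomorph.ext (hmul g k)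

end Topology

theorem exists_mem_Ioo_ne_zero {α M : Type*} [LinearOrder α] [TopologicalSpace α]
    [OrderTopology α] [DenselyOrdered α] [TopologicalSpace M] [TopologicalSpace.SeparableSpace M]
    [Nonempty M] {q : α → M} (hq : IsOpenMap q) {l : M → ℝ}
    (hl : ∀ i, 0 < l (TopologicalSpace.denseSeq M i)) {x y : α} (hxy : x < y) :
    ∃ z ∈ Ioo x y, l (q z) ≠ 0 := by
  obtain ⟨i, z, hz, hi⟩ := (TopologicalSpace.denseRange_denseSeq M).exists_mem_open
    (hq _ isOpen_Ioo) ((nonempty_Ioo.2 hxy).image q)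
  exact ⟨z, hz, by rw [hi]; exact (hl i).ne'⟩

/-! ### The interval -/

section Interval

theorem exists_blowUpData_Icc {l : Icc (0 : ℝ) 1 → ℝ} (h0 : ∀ x, 0 ≤ l x) (hl : HasSum l 1)
    (hd : ∀ i, 0 < l (TopologicalSpace.denseSeq _ i)) :
    ∃ D : BlowUpData (Icc (0 : ℝ) 1), D.l = l ∧ D.T = Icc 0 1 := by
  classical
  have hsum : ∀ a b, Summable fun z : Ico (a : Icc (0 : ℝ) 1) b => l z := fun a b =>
    hl.summable.subtype _
  have hP0 : cumulative l 0 0 = 0 := by simp [cumulative]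
  have hlow : ∀ x, 0 ≤ cumulative l 0 x := fun x => by
    have h := hasSum_cumulative (o := 0) h0 hsum (x := 0) (y := x) x.2.1
    have := h.nonneg fun z => h0 _
    linarith
  have hadd : ∀ x, HasSum ((Iic x).indicator l) (cumulative l 0 x + l x) := fun x => by
    have h := (hasSum_subtype_iff_indicator (f := l)).1
      (hasSum_cumulative (o := 0) h0 hsum (x := 0) (y := x) x.2.1)
    rw [hP0, sub_zero] at h
    convert! h.add (hasSum_ite_eq x (l x)) using 2 with z
    rcases lt_trichotomy z x with hz | rfl | hz
    · simp [indicator, hz, hz.le, hz.ne]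
    · simp [indicator]
    · simp [indicator, hz.not_gt, hz.not_ge, hz.ne']
  have hup : ∀ x, cumulative l 0 x + l x ≤ 1 := fun x =>
    hasSum_le (fun z => indicator_le_self' (fun z _ => h0 z) z) (hadd x) hl
  have htop : cumulative l 0 1 + l 1 = 1 := by
    have h := hadd 1
    have : Iic (1 : Icc (0 : ℝ) 1) = univ := eq_univ_of_forall fun z => z.2.2
    rw [this, indicator_univ] at h
    exact h.unique hl
  exact ⟨BlowUpData.ofLength l 0 (Icc 0 1) h0 hsum
    (fun x y hxy => exists_mem_Ioo_ne_zero IsOpenMap.id hd hxy)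
    (fun A _ _ => ⟨sSup A, isLUB_sSup A⟩)
    (fun t ht => ⟨0, hP0.trans_le ht.1⟩) (fun t ht => ⟨1, ht.2.trans_eq htop.symm⟩)
    (fun x => Icc_subset_Icc (hlow x) (hup x)) ordConnected_Icc (uniqueDiffOn_Icc one_pos), rfl, rfl⟩

theorem exists_isC1Action_isBlowUp_Icc {G : Type*} [Group G] [Countable G]
    (hG : ∀ H : Subgroup G, H.FG → ¬ HasExponentialGrowth H)
    (ρ : G →* (Icc (0 : ℝ) 1 ≃ₜ Icc (0 : ℝ) 1)) :
    ∃ ρ' : G →* (Icc (0 : ℝ) 1 ≃ₜ Icc (0 : ℝ) 1), IsC1Action (𝓡∂ 1) ρ' ∧ IsBlowUp ρ' ρ := by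
  obtain ⟨l, hl0, hl1, hld, hlz, hlf⟩ :=
    exists_weight hG ρ (TopologicalSpace.denseSeq _) one_pos
  obtain ⟨D, rfl, hT⟩ := exists_blowUpData_Icc hl0 hl1 hld
  have hadm : ∀ g, D.Admissible (ρ g) := fun g =>
    { monotone := (ρ g).continuous.strictMono_of_inj_boundedOrder' (ρ g).injective
      surjective := (ρ g).surjective
      compatible := ⟨fun x => hlz g x, fun δ hδ a b => (hlf g δ hδ).subset fun z hz => ⟨hz.1, hz.2.1⟩⟩ }
  have hTm : ∀ {t : Icc (0 : ℝ) 1}, (t : ℝ) ∈ D.T := fun {t} => by rw [hT]; exact t.2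
  have hmem : ∀ g (t : Icc (0 : ℝ) 1), D.blow (ρ g) t ∈ Icc (0 : ℝ) 1 := fun g t => by
    have h := BlowUpData.blow_mem_T (hadm g).compatible (hTm (t := t))
    rwa [hT] at h
  have hsmooth : ∀ g, ContMDiff (𝓡∂ 1) 𝓘(ℝ, ℝ) 1 fun t : Icc (0 : ℝ) 1 => D.blow (ρ g) t := by
    intro g
    have h := (BlowUpData.contDiffOn_blow (hadm g)).contMDiffOn
    exact h.comp_contMDiff contMDiff_subtypeVal_Icc fun t => hTm
  let φ : G → Icc (0 : ℝ) 1 → Icc (0 : ℝ) 1 := fun g t => ⟨D.blow (ρ g) t, hmem g t⟩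
  have hcont : ∀ g, Continuous (φ g) := fun g => (hsmooth g).continuous.subtype_mk _
  let ρ' := homeomorphAction φ
    (fun t => Subtype.ext <| by
      change D.blow (ρ 1) t = t
      rw [map_one]
      exact BlowUpData.blow_id hTm)
    (fun g k t => Subtype.ext <| by
      change D.blow (ρ (g * k)) t = D.blow (ρ g) (D.blow (ρ k) t)
      rw [map_mul]
      exact BlowUpData.blow_comp (hadm g) (hadm k) hTm) hcont
  have hmono : Monotone fun t : Icc (0 : ℝ) 1 => D.h t := fun s t hst =>
    D.monotoneOn_h hTm hTm hst
  have hsurj : Function.Surjective fun t : Icc (0 : ℝ) 1 => D.h t := fun x =>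
    ⟨⟨D.P x, hT.subset (D.P_mem x)⟩, D.h_P x⟩
  have hc := hmono.continuous_of_surjective hsurj
  refine ⟨ρ', fun g => contMDiff_iff_comp_subtypeVal_Icc.2 ⟨hcont g, hsmooth g⟩, fun t => D.h t, hc,
    hsurj, fun J hJ => ?_, fun g t => BlowUpData.h_blow (hadm g).compatible hTm⟩
  refine hJ.preimage_of_isClosedMap_of_fibers hc.isClosedMap hsurj fun y => ?_
  exact (ordConnected_singleton.preimage_mono hmono).isPreconnected

end Interval

/-! ### The circle, through its universal cover -/

section Circle

open Real

theorem Circle.exists_int_of_exp_comp_eq {A : Type*} [TopologicalSpace A] [PreconnectedSpace A]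
    [Nonempty A] {F F' : A → ℝ} (hF : Continuous F) (hF' : Continuous F')
    (h : ∀ x, Circle.exp (F x) = Circle.exp (F' x)) : ∃ n : ℤ, ∀ x, F x = F' x + n * (2 * π) := by
  obtain ⟨a⟩ := ‹Nonempty A›
  obtain ⟨n, hn⟩ := Circle.exp_eq_exp.1 (h a)
  refine ⟨n, fun x => congrFun (Circle.isCoveringMap_exp.eq_of_comp_eq hF
    (by fun_prop : Continuous fun x => F' x + n * (2 * π)) ?_ a hn) x⟩
  funext y
  simp only [Function.comp_apply]
  rw [h y]
  exact Circle.exp_eq_exp.2 ⟨-n, by push_cast; ring⟩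

theorem Circle.exists_lift (f : C(Circle, Circle)) :
    ∃ F : ℝ → ℝ, Continuous F ∧ ∀ x, Circle.exp (F x) = f (Circle.exp x) := by
  obtain ⟨e, he⟩ := Circle.exp_surjective (f (Circle.exp 0))
  obtain ⟨F, ⟨-, hF⟩, -⟩ := Circle.isCoveringMap_exp.existsUnique_continuousMap_lifts
    (f.comp Circle.exp) 0 e he
  exact ⟨F, F.continuous, fun x => congrFun hF x⟩

theorem Circle.exp_bijective_Ico (a : ℝ) :
    Function.Bijective fun z : Ico a (a + 2 * π) => Circle.exp z := by
  constructor
  · rintro ⟨x, hx⟩ ⟨y, hy⟩ h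
    exact Subtype.ext (Circle.exp_injOn_Ico (by linarith) hx hy h)
  · intro w
    obtain ⟨x, rfl⟩ := Circle.exp_surjective w
    refine ⟨⟨_, toIcoMod_mem_Ico two_pi_pos a x⟩, Circle.exp_eq_exp.2
      ⟨-toIcoDiv two_pi_pos a x, ?_⟩⟩
    have := self_sub_toIcoDiv_zsmul two_pi_pos a x
    rw [zsmul_eq_mul] at this
    push_cast
    linarith

theorem Circle.exists_le_add_nat_mul_two_pi (a b : ℝ) : ∃ n : ℕ, b ≤ a + n * (2 * π) := by
  obtain ⟨n, hn⟩ := exists_nat_ge ((b - a) / (2 * π))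
  rw [div_le_iff₀ two_pi_pos] at hn
  exact ⟨n, by linarith⟩

theorem Circle.finite_preimage_exp {S : Set Circle} (hS : S.Finite) (a b : ℝ) :
    {z | Circle.exp z ∈ S ∧ z ∈ Ico a b}.Finite := by
  have key : ∀ n : ℕ, {z | Circle.exp z ∈ S ∧ z ∈ Ico a (a + n * (2 * π))}.Finite := by
    intro n
    induction n with
    | zero => simp
    | succ n ih =>
      have h2 : (Circle.exp ⁻¹' S ∩ Ico (a + n * (2 * π)) (a + n * (2 * π) + 2 * π)).Finite :=
        Finite.of_finite_image (hS.subset (by rintro _ ⟨z, hz, rfl⟩; exact hz.1))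
          ((Circle.exp_injOn_Ico (by linarith)).mono inter_subset_right)
      refine (ih.union h2).subset ?_
      rintro z ⟨hz, hz1, hz2⟩
      push_cast at hz2
      rcases lt_or_ge z (a + n * (2 * π)) with h | h
      · exact .inl ⟨hz, hz1, h⟩
      · exact .inr ⟨hz, h, by linarith⟩
  obtain ⟨n, hn⟩ := Circle.exists_le_add_nat_mul_two_pi a b
  exact (key n).subset fun z hz => ⟨hz.1, hz.2.1, hz.2.2.trans_le hn⟩

theorem Circle.hasSum_comp_exp {l : Circle → ℝ} {c : ℝ} (hl : HasSum l c) (a : ℝ) :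
    HasSum (fun z : Ico a (a + 2 * π) => l (Circle.exp z)) c :=
  (Equiv.ofBijective _ (Circle.exp_bijective_Ico a)).hasSum_iff.2 hl

theorem Circle.summable_comp_exp {l : Circle → ℝ} (hl : Summable l) (a b : ℝ) :
    Summable fun z : Ico a b => l (Circle.exp z) := by
  have key : ∀ n : ℕ, Summable fun z : Ico a (a + n * (2 * π)) => l (Circle.exp z) := by
    intro n
    induction n with
    | zero =>
      have : IsEmpty (Ico a (a + (0 : ℕ) * (2 * π))) := by simp
      exact summable_empty
    | succ n ih =>
      have h2 := (Circle.hasSum_comp_exp hl.hasSum (a + n * (2 * π))).summable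
      have hu : Ico a (a + n * (2 * π)) ∪ Ico (a + n * (2 * π)) (a + n * (2 * π) + 2 * π) =
          Ico a (a + (n + 1 : ℕ) * (2 * π)) := by
        rw [Ico_union_Ico_eq_Ico]
        · push_cast; ring_nf
        · have := two_pi_pos; nlinarith [n.cast_nonneg (α := ℝ)]
        · linarith [two_pi_pos]
      rw [← hu]
      exact (HasSum.add_disjoint (f := fun z => l (Circle.exp z))
        (Ico_disjoint_Ico_same (a := a) (b := a + n * (2 * π))) ih.hasSum h2.hasSum).summable
  obtain ⟨n, hn⟩ := Circle.exists_le_add_nat_mul_two_pi a b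
  exact (key n).comp_injective (i := inclusion (Ico_subset_Ico_right hn)) (inclusion_injective _)

/-- The lifted lengths have mass `2π` in every period, so `P` commutes with translation by `2π`.
This lets the blow-up descend to the circle and makes it fill the line. -/
theorem exists_blowUpData_real {l : Circle → ℝ} (h0 : ∀ x, 0 ≤ l x) (hl : HasSum l (2 * π))
    (hd : ∀ i, 0 < l (TopologicalSpace.denseSeq _ i)) :
    ∃ D : BlowUpData ℝ, (∀ x, D.l x = l (Circle.exp x)) ∧ D.T = univ ∧
      ∀ (x : ℝ) (n : ℤ), D.P (x + n * (2 * π)) = D.P x + n * (2 * π) := by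
  set m : ℝ → ℝ := fun x => l (Circle.exp x) with hm
  have hm0 : ∀ x, 0 ≤ m x := fun x => h0 _
  have hsum : ∀ a b : ℝ, Summable fun z : Ico a b => m z := Circle.summable_comp_exp hl.summable
  have hper : Function.Periodic (fun x => cumulative m 0 x - x) (2 * π) := fun x => by
    have h := (hasSum_cumulative (o := 0) hm0 hsum (x := x) (y := x + 2 * π)
      (by linarith [two_pi_pos])).unique (Circle.hasSum_comp_exp hl x)
    change cumulative m 0 (x + 2 * π) - (x + 2 * π) = cumulative m 0 x - x
    linarith
  have hper' : ∀ (x : ℝ) (n : ℤ), cumulative m 0 (x + n * (2 * π)) =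
      cumulative m 0 x + n * (2 * π) := fun x n => by
    have h : cumulative m 0 (x + n * (2 * π)) - (x + n * (2 * π)) = cumulative m 0 x - x :=
      hper.int_mul n x
    linarith
  refine ⟨BlowUpData.ofLength m 0 univ hm0 hsum
    (fun x y hxy => exists_mem_Ioo_ne_zero isLocalHomeomorph_circleExp.isOpenMap hd hxy)
    (fun A h1 h2 => ⟨sSup A, isLUB_csSup h1 h2⟩) (fun t _ => ?_) (fun t _ => ?_)
    (fun x => subset_univ _) ordConnected_univ uniqueDiffOn_univ, fun x => rfl, rfl, hper'⟩
  · obtain ⟨n, hn⟩ := Circle.exists_le_add_nat_mul_two_pi t (cumulative m 0 0)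
    refine ⟨0 + (-n : ℤ) * (2 * π), ?_⟩
    rw [hper']
    push_cast
    linarith
  · obtain ⟨n, hn⟩ := Circle.exists_le_add_nat_mul_two_pi (cumulative m 0 0) t
    refine ⟨0 + (n : ℤ) * (2 * π), ?_⟩
    rw [hper']
    push_cast
    linarith [hm0 (0 + (n : ℝ) * (2 * π))]

theorem contMDiff_circle_of_lift {f : Circle → Circle} {B : ℝ → ℝ} (hB : ContDiff ℝ 1 B)
    (h : ∀ x, f (Circle.exp x) = Circle.exp (B x)) : ContMDiff (𝓡 1) (𝓡 1) 1 f := by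
  have : Fact (Module.finrank ℝ ℂ = 1 + 1) := finrank_real_complex_fact'
  intro z₀
  obtain ⟨t₀, rfl⟩ := Circle.exp_surjective z₀
  -- A section of the exponential on the whole circle; the rotation moves the cut of the logarithm
  -- away from the base point, near which `A` is smooth.
  let A : Circle → ℝ := fun z => (Complex.log ((z : ℂ) * ((Circle.exp t₀ : Circle) : ℂ)⁻¹)).im + t₀
  have hA : ∀ z, Circle.exp (A z) = z := fun z => by
    have : (z : ℂ) * ((Circle.exp t₀ : Circle) : ℂ)⁻¹ = ((z * (Circle.exp t₀)⁻¹ : Circle) : ℂ) := by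
      simp
    simp only [A]
    rw [this, Complex.log_im, Circle.exp_add, Circle.exp_arg]
    simp
  have hfA : f = fun z => Circle.exp (B (A z)) := funext fun z => by rw [← h, hA]
  rw [hfA]
  have hc : ContMDiff (𝓡 1) 𝓘(ℝ, ℂ) 1 fun z : Circle => (z : ℂ) := contMDiff_coe_sphere
  have hg : ContDiffAt ℝ 1 (fun w : ℂ =>
      B ((Complex.log (w * ((Circle.exp t₀ : Circle) : ℂ)⁻¹)).im + t₀))
      ((Circle.exp t₀ : Circle) : ℂ) := by
    refine hB.contDiffAt.comp _ (ContDiffAt.add ?_ contDiffAt_const)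
    refine ContDiffAt.comp (g := fun w : ℂ => w.im) _ Complex.imCLM.contDiff.contDiffAt ?_
    refine ContDiffAt.comp (g := Complex.log) _ ?_ (contDiffAt_id.mul contDiffAt_const)
    refine (Complex.contDiffAt_log ?_).restrict_scalars ℝ
    rw [mul_inv_cancel₀ (Circle.coe_ne_zero _)]
    exact Complex.one_mem_slitPlane
  exact contMDiff_circleExp.contMDiffAt.comp _ (hg.contMDiffAt.comp _ hc.contMDiffAt)

theorem exists_isC1Action_isBlowUp_circle {G : Type*} [Group G] [Countable G]
    (hG : ∀ H : Subgroup G, H.FG → ¬ HasExponentialGrowth H) (ρ : G →* (Circle ≃ₜ Circle)) :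
    ∃ ρ' : G →* (Circle ≃ₜ Circle), IsC1Action (𝓡 1) ρ' ∧ IsBlowUp ρ' ρ := by
  obtain ⟨l, hl0, hl1, hld, hlz, hlf⟩ :=
    exists_weight hG ρ (TopologicalSpace.denseSeq _) two_pi_pos
  obtain ⟨D, hDl, hT, hP⟩ := exists_blowUpData_real hl0 hl1 hld
  have hTm : ∀ t, t ∈ D.T := fun t => hT ▸ mem_univ t
  have hlper : ∀ (x : ℝ) (n : ℤ), D.l (x + n * (2 * π)) = D.l x := fun x n => by
    rw [hDl, hDl, Circle.exp_eq_exp.2 ⟨n, rfl⟩]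
  have hh : ∀ (t : ℝ) (n : ℤ), D.h (t + n * (2 * π)) = D.h t + n * (2 * π) := fun t n => by
    have := D.h_mem (hTm t)
    refine D.h_eq ?_
    rw [hP, hlper]
    exact ⟨by linarith [this.1], by linarith [this.2]⟩
  have hmono : Monotone D.h := fun s t hst => D.monotoneOn_h (hTm s) (hTm t) hst
  have hsurj : Function.Surjective D.h := fun x => ⟨D.P x, D.h_P x⟩
  have hcont : Continuous D.h := hmono.continuous_of_surjective hsurj
  -- The chosen lifts need not form an action: `F g ∘ F k` and `F (g * k)` differ by a multiple of
  -- `2π`. Their blow-ups differ by the same multiple, which disappears on the circle.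
  choose F hFc hF using fun g => Circle.exists_lift (ρ g : C(Circle, Circle))
  have hF : ∀ g x, Circle.exp (F g x) = ρ g (Circle.exp x) := hF
  have hFmul : ∀ g k, ∃ n : ℤ, ∀ x, F g (F k x) = F (g * k) x + n * (2 * π) := fun g k =>
    Circle.exists_int_of_exp_comp_eq ((hFc g).comp (hFc k)) (hFc _) fun x => by
      rw [hF, hF, hF, map_mul, Homeomorph.mul_apply]
  have hFone : ∃ n : ℤ, ∀ x, F 1 x = x + n * (2 * π) :=
    Circle.exists_int_of_exp_comp_eq (hFc 1) continuous_id fun x => by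
      rw [hF, map_one, Homeomorph.one_apply]
  have hFper : ∀ g (m : ℤ), ∃ n : ℤ, ∀ x, F g (x + m * (2 * π)) = F g x + n * (2 * π) := fun g m =>
    Circle.exists_int_of_exp_comp_eq ((hFc g).comp (continuous_id.add continuous_const)) (hFc g)
      fun x => by rw [hF, hF, Circle.exp_eq_exp.2 ⟨m, rfl⟩]
  have hinv : ∀ g k, g * k = 1 → ∃ n : ℤ, ∀ x, F g (F k x) = x + n * (2 * π) := by
    intro g k hgk
    obtain ⟨n, hn⟩ := hFmul g k
    obtain ⟨m, hm⟩ := hFone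
    exact ⟨m + n, fun x => by rw [hn, hgk, hm]; push_cast; ring⟩
  have hadm : ∀ g, D.Admissible (F g) := by
    intro g
    refine ⟨(hFc g).strictMono_of_inj ?_, ?_, fun x => ?_, fun δ hδ a b => ?_⟩
    · obtain ⟨n, hn⟩ := hinv g⁻¹ g (inv_mul_cancel g)
      intro x y hxy
      have h1 := hn x
      rw [hxy, hn y] at h1
      linarith
    · obtain ⟨n, hn⟩ := hinv g g⁻¹ (mul_inv_cancel g)
      exact fun y => ⟨F g⁻¹ (y - n * (2 * π)), by rw [hn]; ring⟩
    · rw [hDl, hDl, hF, hlz]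
    -- Each of the finitely many bad points of the circle has infinitely many lifts, but only
    -- finitely many in a bounded window. The `+ 1` merely turns the closed bound `z ≤ D.h b` into a
    -- half-open one.
    · refine (Circle.finite_preimage_exp (hlf g δ hδ) (D.h a) (D.h b + 1)).subset ?_
      rintro z ⟨h1, h2, h3, h4⟩
      rw [hDl, hDl, hF] at h2
      rw [hDl] at h1
      refine ⟨⟨h1, h2⟩, ?_, ?_⟩
      · have := hmono h3
        rwa [D.h_eq ⟨by linarith [D.l_nonneg z], le_rfl⟩] at this
      · have := hmono h4
        rw [D.h_P] at this
        linarith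
  have hadd : ∀ (f k : ℝ → ℝ) (n : ℤ), (∀ x, f x = k x + n * (2 * π)) →
      ∀ t, D.blow f t = D.blow k t + n * (2 * π) := by
    intro f k n hfk t
    have hm : StrictMono f ↔ StrictMono k := by simp only [StrictMono, hfk, add_lt_add_iff_right]
    by_cases hk : StrictMono k
    · simp only [BlowUpData.blow, hfk, hP, hlper, if_pos hk, if_pos (hm.2 hk)]
      ring
    · simp only [BlowUpData.blow, hfk, hP, hlper, if_neg hk, if_neg (mt hm.1 hk)]
      ring
  have hBper : ∀ g (m : ℤ) t, ∃ n : ℤ,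
      D.blow (F g) (t + m * (2 * π)) = D.blow (F g) t + n * (2 * π) := by
    intro g m t
    obtain ⟨n, hn⟩ := hFper g m
    refine ⟨n, ?_⟩
    simp only [BlowUpData.blow, hh, hn, hP, hlper, add_sub_add_right_eq_sub]
    ring
  let φ : G → Circle → Circle := fun g z => Circle.exp (D.blow (F g) (Complex.arg z))
  have hφ : ∀ g t, φ g (Circle.exp t) = Circle.exp (D.blow (F g) t) := by
    intro g t
    obtain ⟨m, hm⟩ := Circle.exp_eq_exp.1 (Circle.exp_arg (Circle.exp t))
    obtain ⟨n, hn⟩ := hBper g m t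
    exact Circle.exp_eq_exp.2 ⟨n, by rw [hm, hn]⟩
  have hsmooth : ∀ g, ContMDiff (𝓡 1) (𝓡 1) 1 (φ g) := fun g => by
    refine contMDiff_circle_of_lift ?_ (hφ g)
    have := BlowUpData.contDiffOn_blow (hadm g)
    rwa [hT, contDiffOn_univ] at this
  let ρ' := homeomorphAction φ
    (fun z => by
      obtain ⟨t, rfl⟩ := Circle.exp_surjective z
      obtain ⟨n, hn⟩ := hFone
      rw [hφ]
      exact Circle.exp_eq_exp.2 ⟨n, by rw [hadd (F 1) id n hn, BlowUpData.blow_id (hTm t)]⟩)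
    (fun g k z => by
      obtain ⟨t, rfl⟩ := Circle.exp_surjective z
      obtain ⟨n, hn⟩ := hFmul g k
      rw [hφ (g * k) t, hφ k t, hφ g, ← BlowUpData.blow_comp (hadm g) (hadm k) (hTm t)]
      exact (Circle.exp_eq_exp.2 ⟨n, hadd (F g ∘ F k) (F (g * k)) n hn t⟩).symm)
    fun g => (hsmooth g).continuous
  let H : Circle → Circle := fun z => Circle.exp (D.h (Complex.arg z))
  have hH : ∀ t, H (Circle.exp t) = Circle.exp (D.h t) := by
    intro t
    obtain ⟨m, hm⟩ := Circle.exp_eq_exp.1 (Circle.exp_arg (Circle.exp t))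
    exact Circle.exp_eq_exp.2 ⟨m, by rw [hm, hh]⟩
  have hHc : Continuous H :=
    (Circle.isCoveringMap_exp.isQuotientMap Circle.exp_surjective).continuous_iff.2 <|
      (Circle.exp.continuous.comp hcont).congr fun t => (hH t).symm
  have hHs : Function.Surjective H := fun z => by
    obtain ⟨x, rfl⟩ := Circle.exp_surjective z
    obtain ⟨t, rfl⟩ := hsurj x
    exact ⟨_, hH t⟩
  refine ⟨ρ', hsmooth, H, hHc, hHs, fun J hJ => ?_, fun g z => ?_⟩
  · refine hJ.preimage_of_isClosedMap_of_fibers hHc.isClosedMap hHs fun y => ?_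
    obtain ⟨x, rfl⟩ := Circle.exp_surjective y
    -- By equivariance under `2π`, every point of the fiber has a lift that `D.h` sends to `x`
    -- itself; the fiber is thus the image of an order-connected set.
    have : H ⁻¹' {Circle.exp x} = Circle.exp '' (D.h ⁻¹' {x}) := by
      ext z
      constructor
      · intro hz
        obtain ⟨t, rfl⟩ := Circle.exp_surjective z
        obtain ⟨n, hn⟩ := Circle.exp_eq_exp.1 ((hH t).symm.trans hz)
        refine ⟨t + (-n : ℤ) * (2 * π), ?_, Circle.exp_eq_exp.2 ⟨-n, rfl⟩⟩
        rw [mem_preimage, hh, hn, mem_singleton_iff]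
        push_cast
        ring
      · rintro ⟨t, ht, rfl⟩
        rw [mem_preimage, hH, ht, mem_singleton_iff]
    rw [this]
    exact (ordConnected_singleton.preimage_mono hmono).isPreconnected.image _
      Circle.exp.continuous.continuousOn
  · obtain ⟨t, rfl⟩ := Circle.exp_surjective z
    change H (φ g (Circle.exp t)) = _
    rw [hφ, hH, hH, BlowUpData.h_blow (hadm g).compatible (hTm t), hF]

end Circle

theorem corollary1p2 {G : Type*} [Group G] [Countable G]
    (hG : ∀ H : Subgroup G, H.FG → ¬ HasExponentialGrowth H) :
    (∀ ρ : G →* (Set.Icc (0 : ℝ) 1 ≃ₜ Set.Icc (0 : ℝ) 1),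
      ∃ ρ' : G →* (Set.Icc (0 : ℝ) 1 ≃ₜ Set.Icc (0 : ℝ) 1),
        IsC1Action (𝓡∂ 1) ρ' ∧ IsBlowUp ρ' ρ) ∧
    (∀ ρ : G →* (Circle ≃ₜ Circle),
      ∃ ρ' : G →* (Circle ≃ₜ Circle),
        IsC1Action (𝓡 1) ρ' ∧ IsBlowUp ρ' ρ) :=
  ⟨exists_isC1Action_isBlowUp_Icc hG, exists_isC1Action_isBlowUp_circle hG⟩
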